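/- Conventions. All manifolds and maps are $C^\infty$. A homotopy sphere $\Sigma^n$ is a closed smooth $n$-manifold homotopy equivalent to $S^n$; $D^p\subset\mathbb R^p$ is the closed unit ball. For $n\ge p\ge 1$, a smooth map $f\colon M^n\to\mathbb R^p$ is *special generic* if every singular point of $f$ is a definite fold point, i.e. there are local coordinates centred at the point and around its image in which $f$ has the form $(x_1,\dots,x_n)\mapsto(x_1,\dots,x_{p-1},\pm(x_p^2+\dots+x_n^2))$. The Stein factorization of $f$ is $f=\overline f\circ q_f$, where $q_f\colon M^n\to W_f$ is the quotient map (with the quotient topology on $W_f$) that identifies two points iff they lie in the same connected component of a fibre of $f$. For $p<n$ and $f$ special generic on a closed connected manifold $M^n$, $W_f$ carries its (unique) structure of a smooth $p$-manifold with boundary for which $q_f$ is smooth, $q_f^{-1}(\partial W_f)$ is the singular locus of $f$, and $\overline f\colon W_f\to\mathbb R^p$ is an immersion. A special generic map $f\colon\Sigma^n\to\mathbb R^p$ with $p<n$ on a homotopy sphere is *standard* if $W_f$ is diffeomorphic to $D^p$. Statement. Let $f\colon\Sigma^n\to\mathbb R^p$ be a standard special generic map, fix a diffeomorphism $W_f\cong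 D^p$, and let $h\colon\Sigma^n\xrightarrow{q_f}W_f\xrightarrow{\cong}D^p\hookrightarrow\mathbb R^p$. Then $h$ is a standard special generic map, and for every $q\in\{1,\dots,p-1\}$ the composition $\pi\circ h\colon\Sigma^n\to\mathbb R^q$ of $h$ with the projection $\pi\colon\mathbb R^p\to\mathbb R^q$ to the first $q$ coordinates is a standard special generic map. -/

import Mathlib

open scoped Manifold ContDiff Topology

/-- A homotopy `n`-sphere: a closed (compact, Hausdorff, boundaryless) smooth `n`-manifold
homotopy equivalent to the standard sphere `S^n`. -/
structure IsHomotopySphere (n : ℕ) (M : Type*) [TopologicalSpace M]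
    [ChartedSpace (EuclideanSpace ℝ (Fin n)) M] : Prop where
  isManifold : IsManifold (𝓡 n) ∞ M
  compactSpace : CompactSpace M
  t2Space : T2Space M
  homotopyEquiv : Nonempty (ContinuousMap.HomotopyEquiv M
    (Metric.sphere (0 : EuclideanSpace ℝ (Fin (n + 1))) 1))

section SpecialGeneric

variable (n : ℕ) {p : ℕ} {M : Type*} [TopologicalSpace M]
  [ChartedSpace (EuclideanSpace ℝ (Fin n)) M]

/-- The singular locus `S(f)` of `f : M^n → ℝ^p` with `p ≤ n`: the points where the differential
does not have rank `p`. -/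
def singularLocus (f : M → EuclideanSpace ℝ (Fin p)) : Set M :=
  {x | ¬ Function.Surjective (mfderiv (𝓡 n) (𝓡 p) f x)}

/-- `x` is a fold point of `f` with exactly `l` positive squares: in smooth local coordinates `φ`
centred at `x` and `ψ` around `f x`, the map `f` is
`(x₁, …, xₙ) ↦ (x₁, …, x_{p-1}, x_p² + ⋯ + x_{p+l-1}² - x_{p+l}² - ⋯ - xₙ²)`.
(Indices in `Fin` start at `0`, so `x_k` is the coordinate with index `k - 1`.) -/
def IsFoldPointWith (f : M → EuclideanSpace ℝ (Fin p)) (x : M) (l : ℕ) : Prop :=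
  l ≤ n + 1 - p ∧
  ∃ φ ∈ IsManifold.maximalAtlas (𝓡 n) ∞ M,
  ∃ ψ ∈ IsManifold.maximalAtlas (𝓡 p) ∞ (EuclideanSpace ℝ (Fin p)),
    x ∈ φ.source ∧ φ x = 0 ∧ Set.MapsTo f φ.source ψ.source ∧
    ∀ z ∈ φ.source,
      (∀ (i : Fin p) (j : Fin n), (i : ℕ) = j → (i : ℕ) + 1 < p → ψ (f z) i = φ z j) ∧
      (∀ i : Fin p, (i : ℕ) + 1 = p →
        ψ (f z) i = ∑ j : Fin n,
          if (j : ℕ) + 1 < p then 0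
          else if (j : ℕ) + 1 < p + l then (φ z j) ^ 2 else -(φ z j) ^ 2)

/-- A definite fold point: a fold point of absolute index `max {l, n - p + 1 - l} = n - p + 1`. -/
def IsDefiniteFoldPoint (f : M → EuclideanSpace ℝ (Fin p)) (x : M) : Prop :=
  ∃ l : ℕ, IsFoldPointWith n f x l ∧ max l (n + 1 - p - l) = n + 1 - p

/-- A special generic map `M^n → ℝ^p` (`n ≥ p ≥ 1`): a smooth map whose singular points are all
definite fold points. -/
structure IsSpecialGeneric (f : M → EuclideanSpace ℝ (Fin p)) : Prop where
  one_le : 1 ≤ p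
  le : p ≤ n
  smooth : ContMDiff (𝓡 n) (𝓡 p) ∞ f
  definite : ∀ x ∈ singularLocus n f, IsDefiniteFoldPoint n f x

end SpecialGeneric

section Stein

variable {X Y : Type*} [TopologicalSpace X]

/-- `x₁ ∼ x₂` iff both have the same image `y` and lie in the same connected component of the
fibre over `y`. -/
def steinSetoid (f : X → Y) : Setoid X where
  r x₁ x₂ := f x₁ = f x₂ ∧ x₂ ∈ connectedComponentIn (f ⁻¹' {f x₁}) x₁
  iseqv := by
    refine ⟨fun x => ⟨rfl, mem_connectedComponentIn rfl⟩, ?_, ?_⟩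
    · rintro x y ⟨h, hy⟩
      refine ⟨h.symm, ?_⟩
      rw [← h, ← connectedComponentIn_eq hy]
      exact mem_connectedComponentIn rfl
    · rintro x y z ⟨h, hy⟩ ⟨h', hz⟩
      refine ⟨h.trans h', ?_⟩
      rw [← h, ← connectedComponentIn_eq hy] at hz
      exact hz

/-- The space `W_f = X / ∼_f` of the Stein factorization. -/
def SteinSpace (f : X → Y) : Type _ := Quotient (steinSetoid f)

/-- `W_f` carries the quotient topology. -/
instance (f : X → Y) : TopologicalSpace (SteinSpace f) :=
  inferInstanceAs (TopologicalSpace (Quotient (steinSetoid f)))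

/-- The quotient map `q_f : X → W_f`. -/
def steinQuot (f : X → Y) : X → SteinSpace f := Quotient.mk (steinSetoid f)

/-- The induced map `W_f → Y`. -/
def steinBar (f : X → Y) : SteinSpace f → Y := Quotient.lift f fun _ _ h => h.1

end Stein

section Standard

variable (n : ℕ) {p : ℕ} [NeZero p] {M : Type*} [TopologicalSpace M]
  [ChartedSpace (EuclideanSpace ℝ (Fin n)) M]

/-- The given atlas makes `W_f` a smooth `p`-manifold with boundary such that `q_f` is smooth,
`q_f⁻¹(∂ W_f) = S(f)`, and the induced map `W_f → ℝ^p` is an immersion. (Since the latter is an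
immersion between spaces of the same dimension, there is at most one such smooth structure.) -/
structure IsSteinSmoothStructure (f : M → EuclideanSpace ℝ (Fin p))
    [ChartedSpace (EuclideanHalfSpace p) (SteinSpace f)] : Prop where
  isManifold : IsManifold (𝓡∂ p) ∞ (SteinSpace f)
  smooth_quot : ContMDiff (𝓡 n) (𝓡∂ p) ∞ (steinQuot f)
  preimage_boundary : steinQuot f ⁻¹' ((𝓡∂ p).boundary (SteinSpace f)) = singularLocus n f
  smooth_bar : ContMDiff (𝓡∂ p) (𝓡 p) ∞ (steinBar f)
  injective_mfderiv_bar :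
    ∀ w : SteinSpace f, Function.Injective (mfderiv (𝓡∂ p) (𝓡 p) (steinBar f) w)

/-- `Φ`, composed with the inclusion `D^p ⊂ ℝ^p` of the closed unit ball, is a diffeomorphism of
the manifold with boundary `W` onto `D^p`: it is smooth with image `D^p`, and has an inverse that
is smooth on the subset `D^p` of `ℝ^p` (the values of `Ψ` outside `D^p` are irrelevant). -/
structure IsDiffeoOntoDisk {W : Type*} [TopologicalSpace W] [ChartedSpace (EuclideanHalfSpace p) W]
    (Φ : W → EuclideanSpace ℝ (Fin p)) : Prop where
  range_eq : Set.range Φ = Metric.closedBall 0 1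
  smooth : ContMDiff (𝓡∂ p) (𝓡 p) ∞ Φ
  smooth_inverse : ∃ Ψ : EuclideanSpace ℝ (Fin p) → W,
    ContMDiffOn (𝓡 p) (𝓡∂ p) ∞ Ψ (Metric.closedBall 0 1) ∧ ∀ w, Ψ (Φ w) = w

/-- A standard special generic map `Σ^n → ℝ^p` (`p < n`): a special generic map on a homotopy
sphere whose Stein factorization `W_f`, with its smooth structure, is diffeomorphic to `D^p`. -/
structure IsStandardSpecialGeneric (f : M → EuclideanSpace ℝ (Fin p)) : Prop where
  homotopySphere : IsHomotopySphere n M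
  lt : p < n
  specialGeneric : IsSpecialGeneric n f
  standard : ∃ _ : ChartedSpace (EuclideanHalfSpace p) (SteinSpace f),
    IsSteinSmoothStructure n f ∧ ∃ Φ : SteinSpace f → EuclideanSpace ℝ (Fin p), IsDiffeoOntoDisk Φ

end Standard

/-- The projection `ℝ^p → ℝ^q` to the first `q` coordinates. -/
def projFirst {p q : ℕ} (h : q ≤ p) (x : EuclideanSpace ℝ (Fin p)) : EuclideanSpace ℝ (Fin q) :=
  WithLp.toLp 2 fun i => x (Fin.castLE h i)

/-! Write `h = Φ ∘ q_f` and `g = f̄ ∘ Φ⁻¹`, so that `f = g ∘ h` with `g` smooth on the closed ball.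
Then `h` maps onto the ball with connected fibres, and the singular points of `f` are exactly the
points with `‖h‖ = 1` (`exists_contDiffOn_comp_eq`). Everything is deduced from these facts, and the
claim about `h` itself is the case `q = p` of the claim about projections.

The heart is a local normal form of `h` at a point `x` with `‖h x‖ = 1`. In fold coordinates of `f`
the last coordinate of `f` is, up to sign, the sum `tailSq` of the squares of the transverse
coordinates. It is a `C¹` function of `h` that vanishes on the sphere near `h x`, so it is bounded
by a multiple of the distance of `h` to the sphere. Hence `1 - ‖h‖²`, which vanishes on the singular
locus, grows at least quadratically away from it (`IsDefiniteFoldChart.exists_quadratic_growth`).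
The Morse–Bott lemma `exists_eq_sum_sq_of_quadratic_growth` makes `1 - ‖h‖²` a sum of squares of
transverse coordinates. Together with all but one of the coordinates of `h` they form a chart of `M`
(`exists_isAdaptedChart`); the omitted coordinate may be any one that is nonzero at `x`.

Such charts settle the singularities of `π ∘ h`. It is a submersion at `x` unless `‖h x‖ = 1` and
the coordinates of `h x` from index `q` on vanish. At those points `1 - ‖π h‖² = (1 - ‖h‖²) + ∑_{k ≥
q} h_k²` is a sum of squares of chart coordinates, and `1 - ‖z‖²` is a coordinate of `ℝ^q` near the
unit sphere, so the singularity is a definite fold.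

Globally, the fibres of `π ∘ h` are preimages under `h` of convex slices of the ball and hence
connected. So the Stein space of `π ∘ h` embeds as its image, the unit ball of `ℝ^q`, and inherits
the smooth structure of that ball (`exists_isSteinSmoothStructure`). -/

open MeasureTheory Filter in
/-- Smoothness of integrals depending smoothly on a parameter. -/
theorem contDiff_intervalIntegral_param {V : Type*} [NormedAddCommGroup V] [NormedSpace ℝ V]
    [FiniteDimensional ℝ V] {F : V × ℝ → ℝ} (hF : ContDiff ℝ ∞ F) (a b : ℝ) :
    ContDiff ℝ ∞ fun x => ∫ t in a..b, F (x, t) := by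
  have hd : ∀ {F : V × ℝ → ℝ}, ContDiff ℝ ∞ F → ∀ x₀, HasFDerivAt
      (fun x => ∫ t in a..b, F (x, t))
      (∫ t in a..b, (fderiv ℝ F (x₀, t)).comp (ContinuousLinearMap.inl ℝ V ℝ)) x₀ := by
    intro F hF x₀
    have hc : Continuous F := hF.continuous
    have hc' : Continuous (fun z : V × ℝ =>
        (fderiv ℝ F z).comp (ContinuousLinearMap.inl ℝ V ℝ)) :=
      (hF.continuous_fderiv (by simp)).clm_comp continuous_const
    obtain ⟨C, hC⟩ := ((isCompact_closedBall x₀ 1).prod (isCompact_uIcc (a := a) (b := b))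
      ).exists_bound_of_continuousOn hc'.continuousOn
    refine intervalIntegral.hasFDerivAt_integral_of_dominated_of_fderiv_le
      (F' := fun x t => (fderiv ℝ F (x, t)).comp (ContinuousLinearMap.inl ℝ V ℝ))
      (bound := fun _ => C)
      (Metric.closedBall_mem_nhds x₀ one_pos) ?_ ?_ ?_ ?_ ?_ ?_
    · exact Eventually.of_forall fun x =>
        (hc.comp (by fun_prop : Continuous fun t : ℝ => (x, t))).aestronglyMeasurable
    · exact (hc.comp (by fun_prop : Continuous fun t : ℝ => (x₀, t))).intervalIntegrable _ _
    · exact (hc'.comp (by fun_prop : Continuous fun t : ℝ => (x₀, t))).aestronglyMeasurable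
    · exact Eventually.of_forall fun t ht x hx =>
        hC (x, t) ⟨hx, Set.uIoc_subset_uIcc ht⟩
    · exact intervalIntegrable_const
    · refine Eventually.of_forall fun t _ x _ => ?_
      have h1 : HasFDerivAt F (fderiv ℝ F (x, t)) (x, t) :=
        (hF.differentiable (by simp) _).hasFDerivAt
      exact h1.comp x (hasFDerivAt_prodMk_left x t)
  rw [contDiff_infty]
  intro m
  induction m generalizing F with
  | zero =>
    exact contDiff_zero.2 (intervalIntegral.continuous_parametric_intervalIntegral_of_continuous'
      (f := fun x t => F (x, t)) hF.continuous a b)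
  | succ m ih =>
    push_cast
    -- In finite dimension it suffices to treat each directional derivative, and that is again a
    -- parameter integral of a smooth integrand; hence the induction over all `F`.
    rw [contDiff_succ_iff_fderiv_apply]
    refine ⟨fun x => (hd hF x).differentiableAt, by simp, fun y => ?_⟩
    have : (fun x => fderiv ℝ (fun x => ∫ t in a..b, F (x, t)) x y) =
        fun x => ∫ t in a..b, (fun z => fderiv ℝ F z (y, 0)) (x, t) := by
      ext x
      rw [(hd hF x).fderiv, ContinuousLinearMap.intervalIntegral_apply]
      · simp
      · exact (((hF.continuous_fderiv (by simp)).comp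
          (by fun_prop : Continuous fun t : ℝ => (x, t))).clm_comp
            continuous_const).intervalIntegrable _ _
    rw [this]
    exact ih ((hF.fderiv_right (m := ∞) (by simp)).clm_apply contDiff_const)

/-! ### Smooth factorization of positive definite matrices -/

section MatrixSqrt

attribute [local instance] Matrix.linftyOpNormedRing Matrix.linftyOpNormedAlgebra

open Filter Matrix

/-- Squaring has derivative `2 • id` at `1`, so it has a local inverse there. The root of a
symmetric matrix is symmetric: its transpose is a nearby root of the same matrix, and squaring is
locally injective. -/
theorem exists_smooth_sqrt_near_one (J : Type*) [Fintype J] [DecidableEq J] :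
    ∃ Y : Matrix J J ℝ → Matrix J J ℝ, (∀ᶠ X in 𝓝 1, ContDiffAt ℝ ∞ Y X) ∧
      ∀ᶠ X in 𝓝 1, Xᵀ = X → (Y X)ᵀ * Y X = X := by
  let sq : Matrix J J ℝ → Matrix J J ℝ := fun A => A * A
  -- Analyticity is used because `ContDiffAt` at order `ω` persists at nearby points, whereas at
  -- order `∞` the neighbourhood may shrink with the order.
  have hsq : ContDiff ℝ ω sq := contDiff_id.mul contDiff_id
  let D : Matrix J J ℝ ≃L[ℝ] Matrix J J ℝ :=
    ContinuousLinearEquiv.smulLeft (Units.mk0 (2 : ℝ) two_ne_zero)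
  have hD : HasFDerivAt sq (D : Matrix J J ℝ →L[ℝ] Matrix J J ℝ) 1 := by
    have := (hasFDerivAt_id (𝕜 := ℝ) (1 : Matrix J J ℝ)).mul' (hasFDerivAt_id (𝕜 := ℝ) 1)
    refine this.congr_fderiv ?_
    ext A i j
    change ((1 : Matrix J J ℝ) * A) i j + (A * (1 : Matrix J J ℝ)) i j = (2 : ℝ) * A i j
    rw [one_mul, mul_one, two_mul]
  let e := hsq.contDiffAt.toOpenPartialHomeomorph sq hD (by simp)
  have he : ∀ A, e A = A * A := fun A => rfl
  have h1s : (1 : Matrix J J ℝ) ∈ e.source :=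
    hsq.contDiffAt.mem_toOpenPartialHomeomorph_source hD (by simp)
  have h1 : e 1 = 1 := by simp [he]
  have h1t : (1 : Matrix J J ℝ) ∈ e.target := by simpa [h1] using e.map_source h1s
  have hs1 : e.symm 1 = 1 := by conv_lhs => rw [← h1, e.left_inv h1s]
  refine ⟨e.symm, ?_, ?_⟩
  · have : ContDiffAt ℝ ω e.symm 1 := by
      refine e.contDiffAt_symm (f₀' := D) h1t ?_ ?_
      · rw [hs1]; exact hD
      · exact hsq.contDiffAt
    filter_upwards [this.eventually (by simp)] with X hX using hX.of_le le_top
  · have hc : ContinuousAt e.symm 1 := e.continuousAt_symm h1t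
    have hct : ContinuousAt (fun X => (e.symm X)ᵀ) 1 := by
      have h : Continuous (fun A : Matrix J J ℝ => Aᵀ) := continuous_id.matrix_transpose
      exact h.continuousAt.comp hc
    have hev : ∀ᶠ X in 𝓝 (1 : Matrix J J ℝ), (e.symm X)ᵀ ∈ e.source :=
      hct.eventually_mem (by
        rw [hs1, Matrix.transpose_one]; exact e.open_source.mem_nhds h1s)
    filter_upwards [hev, e.open_target.mem_nhds h1t] with X hX hXt hsymm
    have hXX : e.symm X * e.symm X = X := e.right_inv hXt
    have : (e.symm X)ᵀ = e.symm X := by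
      refine e.injOn hX (e.map_target hXt) ?_
      rw [he, he, hXX, ← Matrix.transpose_mul, hXX, hsymm]
    rw [this, hXX]

-- With `T = Sᵀ S`, the congruence `X ↦ S⁻ᵀ X S⁻¹` moves `T` to the identity, where the square root
-- is available.
open scoped MatrixOrder in
theorem Matrix.PosDef.exists_smooth_factor {J : Type*} [Fintype J] [DecidableEq J]
    {T : Matrix J J ℝ} (hT : T.PosDef) :
    ∃ Λ : Matrix J J ℝ → Matrix J J ℝ, (∀ᶠ X in 𝓝 T, ContDiffAt ℝ ∞ Λ X) ∧
      ∀ᶠ X in 𝓝 T, Xᵀ = X → (Λ X)ᵀ * Λ X = X := by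
  obtain ⟨Y, hY, hY'⟩ := exists_smooth_sqrt_near_one J
  obtain ⟨S, hS⟩ := CStarAlgebra.nonneg_iff_eq_star_mul_self.1
    (Matrix.nonneg_iff_posSemidef.2 hT.posSemidef)
  have hS' : T = Sᵀ * S := by simpa [star_eq_conjTranspose, conjTranspose] using hS
  have hdet : IsUnit S.det := by
    have h := hT.det_pos.ne'
    rw [hS', det_mul, det_transpose] at h
    exact isUnit_iff_ne_zero.2 fun h0 => h (by simp [h0])
  have hdet' : IsUnit Sᵀ.det := by rwa [det_transpose]
  let c : Matrix J J ℝ → Matrix J J ℝ := fun X => Sᵀ⁻¹ * X * S⁻¹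
  have hc : ContDiff ℝ ∞ c := (contDiff_const.mul contDiff_id).mul contDiff_const
  have hcT : c T = 1 := by
    simp only [c, hS']
    rw [← Matrix.mul_assoc, nonsing_inv_mul _ hdet', Matrix.one_mul, mul_nonsing_inv _ hdet]
  have hct : Tendsto c (𝓝 T) (𝓝 1) := by
    have := hc.continuous.tendsto T
    rwa [hcT] at this
  refine ⟨fun X => Y (c X) * S, ?_, ?_⟩
  · filter_upwards [hct.eventually hY] with X hX
    exact (hX.comp X hc.contDiffAt).mul contDiffAt_const
  · filter_upwards [hct.eventually hY'] with X hX hsymm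
    have hcs : (c X)ᵀ = c X := by
      simp only [c, transpose_mul, transpose_nonsing_inv, hsymm, transpose_transpose,
        Matrix.mul_assoc]
    calc (Y (c X) * S)ᵀ * (Y (c X) * S) = Sᵀ * ((Y (c X))ᵀ * Y (c X)) * S := by
          rw [transpose_mul]; simp only [Matrix.mul_assoc]
      _ = Sᵀ * (Sᵀ⁻¹ * X * S⁻¹) * S := by rw [hX hcs]
      _ = (Sᵀ * Sᵀ⁻¹) * X * (S⁻¹ * S) := by simp only [Matrix.mul_assoc]
      _ = X := by rw [mul_nonsing_inv _ hdet', nonsing_inv_mul _ hdet]; simp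

end MatrixSqrt

/-! ### A Morse–Bott lemma from quadratic growth -/

section MorseLemma

attribute [local instance] Matrix.linftyOpNormedRing Matrix.linftyOpNormedAlgebra

open Filter Matrix

variable {V : Type*} [NormedAddCommGroup V] [NormedSpace ℝ V]

/-- Second order Taylor formula at a critical point of height zero. -/
theorem eq_integral_fderiv_fderiv {R : V → ℝ} (hR : ContDiff ℝ ∞ R) {a w : V} (h0 : R a = 0)
    (h1 : fderiv ℝ R a = 0) :
    R (a + w) = ∫ t in (0 : ℝ)..1, (1 - t) * fderiv ℝ (fderiv ℝ R) (a + t • w) w w := by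
  have h := map_add_eq_sum_add_integral_iteratedFDeriv (n := 1) (f := R) (x := a) (y := w)
    (fun t _ => hR.contDiffAt.of_le (by
      rw [← WithTop.coe_natCast]; exact WithTop.coe_le_coe.2 le_top))
  simp only [Nat.reduceAdd, Finset.sum_range_succ, Finset.sum_range_zero, iteratedFDeriv_zero_apply,
    iteratedFDeriv_one_apply, iteratedFDeriv_two_apply, h0, h1, pow_one] at h
  simpa using h

/-- A nonnegative smooth function that vanishes on the kernel of a projection `ϖ` and grows
quadratically away from it is a sum of squares of functions that are coordinates transversally to
this kernel. -/
theorem exists_eq_sum_sq_of_quadratic_growth [FiniteDimensional ℝ V] {J : Type*} [Fintype J]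
    (ϖ : V →L[ℝ] (J → ℝ)) (ι : (J → ℝ) →L[ℝ] V) (hι : ∀ a, ϖ (ι a) = a) {R : V → ℝ}
    (hR : ContDiff ℝ ∞ R) (hnn : ∀ v, 0 ≤ R v) (hz : ∀ v, ϖ v = 0 → R v = 0) {c : ℝ} (hc : 0 < c)
    (hgrow : ∀ᶠ v in 𝓝 0, c * ∑ j, (ϖ v j) ^ 2 ≤ R v) :
    ∃ u : V → J → ℝ, (∀ᶠ v in 𝓝 0, ContDiffAt ℝ ∞ u v) ∧ (∀ᶠ v in 𝓝 0, R v = ∑ j, (u v j) ^ 2) ∧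
      u 0 = 0 ∧ ∀ a, fderiv ℝ u 0 a = 0 → ϖ a = 0 := by
  classical
  let H : V → V →L[ℝ] V →L[ℝ] ℝ := fderiv ℝ (fderiv ℝ R)
  have hH : ContDiff ℝ ∞ H :=
    (hR.fderiv_right (m := ∞) (by simp)).fderiv_right (m := ∞) (by simp)
  let b : J → V := fun j => ι (Pi.single j 1)
  have hb : ∀ a : J → ℝ, ι a = ∑ j, a j • b j := fun a => by
    conv_lhs => rw [← Finset.univ_sum_single a]
    rw [map_sum]
    refine Finset.sum_congr rfl fun j _ => ?_
    rw [← map_smul, ← Pi.single_smul, smul_eq_mul, mul_one]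
  -- The segment from the projection `v - ι (ϖ v)` of `v` to the kernel of `ϖ`, at `t = 0`, to `v`,
  -- at `t = 1`.
  let path : V × ℝ → V := fun z => z.1 - ι (ϖ z.1) + z.2 • ι (ϖ z.1)
  have hpath : ContDiff ℝ ∞ path := by fun_prop
  let T : V → Matrix J J ℝ := fun v => .of fun i j => ∫ t in (0 : ℝ)..1,
    (1 - t) * H (path (v, t)) (b i) (b j)
  have hTs : ContDiff ℝ ∞ T := by
    have hij : ∀ i j, ContDiff ℝ ∞ fun v => T v i j := fun i j =>
      contDiff_intervalIntegral_param (F := fun z => (1 - z.2) * H (path z) (b i) (b j))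
        ((contDiff_const.sub contDiff_snd).mul
          (((hH.comp hpath).clm_apply contDiff_const).clm_apply contDiff_const)) 0 1
    have hpi : ContDiff ℝ ∞ fun v => (fun i j => T v i j : J → J → ℝ) :=
      contDiff_pi.2 fun i => contDiff_pi.2 fun j => hij i j
    let ofL : (J → J → ℝ) →L[ℝ] Matrix J J ℝ :=
      LinearMap.toContinuousLinearMap (Matrix.ofLinearEquiv ℝ : (J → J → ℝ) ≃ₗ[ℝ] _).toLinearMap
    exact ofL.contDiff.comp hpi
  have hsymm : ∀ v, (T v)ᵀ = T v := by
    intro v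
    ext i j
    simp only [T, transpose_apply, of_apply]
    refine intervalIntegral.integral_congr fun t _ => ?_
    have : IsSymmSndFDerivAt ℝ R (path (v, t)) :=
      (hR.of_le (m := 2) (WithTop.coe_le_coe.2 le_top)).contDiffAt.isSymmSndFDerivAt (by simp)
    simp only [H, this.eq (b j) (b i)]
  have hquad : ∀ v, R v = ϖ v ⬝ᵥ T v *ᵥ ϖ v := by
    intro v
    have hk : ϖ (v - ι (ϖ v)) = 0 := by simp [hι]
    have h0 := hz _ hk
    -- `R ≥ 0` attains its minimum `0` on the kernel, so only the second order remainder survives in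
    -- Taylor's formula.
    have h1 : fderiv ℝ R (v - ι (ϖ v)) = 0 := by
      refine IsLocalMin.fderiv_eq_zero (Eventually.of_forall fun w => ?_)
      rw [h0]; exact hnn w
    have h := eq_integral_fderiv_fderiv hR (w := ι (ϖ v)) h0 h1
    rw [sub_add_cancel] at h
    rw [h]
    have hint : ∀ i j, IntervalIntegrable
        (fun t : ℝ => (1 - t) * H (path (v, t)) (b i) (b j)) MeasureTheory.volume 0 1 := by
      intro i j
      refine Continuous.intervalIntegrable ?_ _ _
      have : Continuous fun t : ℝ => H (path (v, t)) :=
        hH.continuous.comp (hpath.continuous.comp (by fun_prop))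
      exact (continuous_const.sub continuous_id).mul
        ((this.clm_apply continuous_const).clm_apply continuous_const)
    have hsum : ∀ t : ℝ, (1 - t) * H (path (v, t)) (ι (ϖ v)) (ι (ϖ v)) =
        ∑ i, ∑ j, ϖ v i * ϖ v j * ((1 - t) * H (path (v, t)) (b i) (b j)) := by
      intro t
      rw [hb]
      simp only [map_sum, map_smul, _root_.sum_apply, _root_.smul_apply,
        smul_eq_mul, Finset.mul_sum]
      rw [Finset.sum_comm]
      refine Finset.sum_congr rfl fun i _ => Finset.sum_congr rfl fun j _ => ?_
      ring
    calc _ = ∫ t in (0 : ℝ)..1,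
          ∑ i, ∑ j, ϖ v i * ϖ v j * ((1 - t) * H (path (v, t)) (b i) (b j)) :=
          intervalIntegral.integral_congr fun t _ => hsum t
      _ = ∑ i, ∑ j, ϖ v i * ϖ v j * T v i j := by
          rw [intervalIntegral.integral_finsetSum]
          · refine Finset.sum_congr rfl fun i _ => ?_
            rw [intervalIntegral.integral_finsetSum]
            · refine Finset.sum_congr rfl fun j _ => ?_
              rw [intervalIntegral.integral_const_mul]
              rfl
            · exact fun j _ => (hint i j).const_mul _
          · intro i _
            simpa only [Finset.sum_fn] using IntervalIntegrable.sum Finset.univ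
              fun j _ => (hint i j).const_mul (ϖ v i * ϖ v j)
      _ = _ := by
          simp only [dotProduct, mulVec, Finset.mul_sum]
          refine Finset.sum_congr rfl fun i _ => Finset.sum_congr rfl fun j _ => ?_
          ring
  have hTc : Tendsto T (𝓝 0) (𝓝 (T 0)) := hTs.continuous.tendsto 0
  -- The growth bound along `s • ι a` is homogeneous of degree two in `s` except for the argument of
  -- `T`; divide by `s ^ 2` and let `s → 0`.
  have hpos : ∀ a : J → ℝ, c * ∑ j, a j ^ 2 ≤ a ⬝ᵥ T 0 *ᵥ a := by
    intro a
    have hs : Tendsto (fun s : ℝ => s • ι a) (𝓝[≠] 0) (𝓝 0) := by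
      have : Tendsto (fun s : ℝ => s • ι a) (𝓝 0) (𝓝 ((0 : ℝ) • ι a)) :=
        (continuous_id.smul continuous_const).tendsto 0
      rw [zero_smul] at this
      exact this.mono_left nhdsWithin_le_nhds
    have hlim : Tendsto (fun s : ℝ => a ⬝ᵥ T (s • ι a) *ᵥ a) (𝓝[≠] 0) (𝓝 (a ⬝ᵥ T 0 *ᵥ a)) := by
      have : Continuous fun X : Matrix J J ℝ => a ⬝ᵥ X *ᵥ a := by fun_prop
      exact (this.tendsto _).comp (hTc.comp hs)
    refine ge_of_tendsto hlim ?_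
    filter_upwards [hs.eventually hgrow, self_mem_nhdsWithin] with s hs1 hs0
    rw [hquad] at hs1
    simp only [map_smul, hι, mulVec_smul, dotProduct_smul, smul_dotProduct, Pi.smul_apply,
      smul_eq_mul, mul_pow, ← Finset.mul_sum] at hs1
    have hs2 : 0 < s ^ 2 := by positivity [show s ≠ 0 from hs0]
    refine le_of_mul_le_mul_left ?_ hs2
    linarith
  have hT0 : (T 0).PosDef := by
    refine PosDef.of_dotProduct_mulVec_pos
      ((conjTranspose_eq_transpose_of_trivial _).trans (hsymm 0)) ?_
    intro a ha
    refine lt_of_lt_of_le ?_ (hpos a)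
    obtain ⟨j, hj⟩ := Function.ne_iff.1 ha
    refine mul_pos hc (Finset.sum_pos' (fun _ _ => sq_nonneg _) ⟨j, Finset.mem_univ _, ?_⟩)
    exact sq_pos_of_ne_zero hj
  obtain ⟨Λ, hΛ, hΛ'⟩ := hT0.exists_smooth_factor
  let u : V → J → ℝ := fun v => Λ (T v) *ᵥ ϖ v
  have hus : ∀ v, ContDiffAt ℝ ∞ Λ (T v) → ContDiffAt ℝ ∞ u v := by
    intro v hv
    refine contDiffAt_pi.2 fun j => ?_
    change ContDiffAt ℝ ∞ (fun v => ∑ k, Λ (T v) j k * ϖ v k) v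
    refine ContDiffAt.sum fun k _ => ?_
    have hent : ContDiff ℝ ∞ fun X : Matrix J J ℝ => X j k :=
      (LinearMap.toContinuousLinearMap (Matrix.entryLinearMap ℝ ℝ j k)).contDiff
    have hk : ContDiff ℝ ∞ fun v => ϖ v k := by fun_prop
    exact (hent.contDiffAt.comp v (hv.comp v hTs.contDiffAt)).mul hk.contDiffAt
  refine ⟨u, ?_, ?_, by simp [u], ?_⟩
  · exact (hTc.eventually hΛ).mono hus
  · filter_upwards [hTc.eventually hΛ'] with v hv
    have := hv (hsymm v)
    rw [hquad]
    nth_rw 1 [← this]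
    rw [← mulVec_mulVec, dotProduct_mulVec, vecMul_transpose]
    simp [dotProduct, u, sq]
  · intro a ha
    have hu0 : HasFDerivAt u (fderiv ℝ u 0) 0 :=
      ((hus 0 hΛ.self_of_nhds).differentiableAt (by simp)).hasFDerivAt
    have hline : HasDerivAt (fun s : ℝ => u (s • a)) 0 0 := by
      have h1 : HasDerivAt (fun s : ℝ => s • a) a 0 := by
        simpa using (hasDerivAt_id (0 : ℝ)).smul_const a
      have h2 : HasFDerivAt u (fderiv ℝ u 0) ((0 : ℝ) • a) := by rwa [zero_smul]
      have h3 := h2.comp_hasDerivAt (0 : ℝ) h1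
      rw [ha] at h3
      exact h3
    -- The difference quotient of `u` along `a` is `Λ (T (s • a)) *ᵥ ϖ a`, so a vanishing derivative
    -- gives `Λ (T 0) *ᵥ ϖ a = 0`, and `T 0` is definite.
    have hm : Tendsto (fun s : ℝ => Λ (T (s • a)) *ᵥ ϖ a) (𝓝[≠] 0) (𝓝 (Λ (T 0) *ᵥ ϖ a)) := by
      have hsa : Tendsto (fun s : ℝ => s • a) (𝓝 0) (𝓝 0) := by
        simpa using (by fun_prop : Continuous fun s : ℝ => s • a).tendsto 0
      have hmul : Continuous fun X : Matrix J J ℝ => X *ᵥ ϖ a := by fun_prop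
      have h := (hmul.tendsto _).comp
        (hΛ.self_of_nhds.continuousAt.tendsto.comp (hTc.comp hsa))
      exact h.mono_left nhdsWithin_le_nhds
    have hm0 : Λ (T 0) *ᵥ ϖ a = 0 := by
      refine tendsto_nhds_unique hm ((hasDerivAt_iff_tendsto_slope.1 hline).congr' ?_)
      filter_upwards [self_mem_nhdsWithin] with s hs
      have hs0 : s ≠ 0 := hs
      simp [slope, u, mulVec_smul, smul_smul, hs0]
    have hTa : T 0 *ᵥ ϖ a = 0 := by
      rw [← hΛ'.self_of_nhds (hsymm 0), ← mulVec_mulVec, hm0, mulVec_zero]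
    have hle := hpos (ϖ a)
    rw [hTa, dotProduct_zero] at hle
    have hsum0 : ∑ j, ϖ a j ^ 2 = 0 :=
      le_antisymm (nonpos_of_mul_nonpos_right hle hc) (Finset.sum_nonneg fun _ _ => sq_nonneg _)
    ext j
    simpa using (Finset.sum_eq_zero_iff_of_nonneg fun _ _ => sq_nonneg _).1 hsum0 j
      (Finset.mem_univ j)

end MorseLemma

/-! ### Smooth changes of coordinates in Euclidean space -/

/-- The inverse function theorem, with the local inverse packaged as a smooth change of
coordinates. -/
theorem exists_mem_contDiffGroupoid_of_injective_fderiv {m : ℕ}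
    {κ : EuclideanSpace ℝ (Fin m) → EuclideanSpace ℝ (Fin m)} {a : EuclideanSpace ℝ (Fin m)}
    (hκ : ∀ᶠ v in 𝓝 a, ContDiffAt ℝ ∞ κ v) (hinj : ∀ w, fderiv ℝ κ a w = 0 → w = 0) :
    ∃ e ∈ contDiffGroupoid ∞ (𝓡 m), a ∈ e.source ∧ ∀ v, e v = κ v := by
  have hequiv : ∃ D : EuclideanSpace ℝ (Fin m) ≃L[ℝ] EuclideanSpace ℝ (Fin m),
      (D : EuclideanSpace ℝ (Fin m) →L[ℝ] EuclideanSpace ℝ (Fin m)) = fderiv ℝ κ a := by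
    refine ⟨(LinearEquiv.ofInjectiveEndo (fderiv ℝ κ a).toLinearMap
      ((injective_iff_map_eq_zero _).2 hinj)).toContinuousLinearEquiv, ?_⟩
    ext w; rfl
  obtain ⟨D, hD⟩ := hequiv
  have ha : ContDiffAt ℝ ∞ κ a := hκ.self_of_nhds
  have hD' : HasFDerivAt κ (D : EuclideanSpace ℝ (Fin m) →L[ℝ] EuclideanSpace ℝ (Fin m)) a := by
    rw [hD]; exact (ha.differentiableAt (by simp)).hasFDerivAt
  let e₀ := ha.toOpenPartialHomeomorph κ hD' (by simp)
  have hfd : ContinuousAt (fderiv ℝ κ) a := (ha.fderiv_right (m := ∞) (by simp)).continuousAt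
  have hinv : ∀ᶠ v in 𝓝 a, fderiv ℝ κ v ∈ Set.range
      ((↑) : (EuclideanSpace ℝ (Fin m) ≃L[ℝ] EuclideanSpace ℝ (Fin m)) →
        (EuclideanSpace ℝ (Fin m) →L[ℝ] EuclideanSpace ℝ (Fin m))) :=
    hfd.eventually_mem (by rw [← hD]; exact ContinuousLinearEquiv.nhds D)
  -- The local inverse must be smooth on all of its domain, so restrict to points where `κ` is
  -- smooth with invertible derivative.
  obtain ⟨s, hs, hso, has⟩ := eventually_nhds_iff.1 (hκ.and hinv)
  refine ⟨e₀.restr s, ?_, ?_, fun v => rfl⟩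
  · rw [contDiffGroupoid, mem_groupoid_of_pregroupoid]
    have hsrc : (e₀.restr s).source = e₀.source ∩ s := by rw [e₀.restr_source, hso.interior_eq]
    constructor
    · simp only [contDiffPregroupoid, modelWithCornersSelf_coe,
        modelWithCornersSelf_coe_symm, Function.id_comp, Function.comp_id, Set.preimage_id,
        Set.range_id, Set.inter_univ]
      intro v hv
      rw [hsrc] at hv
      exact (hs v hv.2).1.contDiffWithinAt
    · simp only [contDiffPregroupoid, modelWithCornersSelf_coe,
        modelWithCornersSelf_coe_symm, Function.id_comp, Function.comp_id, Set.preimage_id,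
        Set.range_id, Set.inter_univ]
      intro v hv
      have hv' := (e₀.restr s).map_target hv
      rw [hsrc] at hv'
      obtain ⟨h1, D', hD'⟩ := hs _ hv'.2
      refine ((e₀.restr s).contDiffAt_symm (f₀' := D') hv ?_ h1).contDiffWithinAt
      rw [hD']
      exact (h1.differentiableAt (by simp)).hasFDerivAt
  · rw [e₀.restr_source, hso.interior_eq]
    exact ⟨ha.mem_toOpenPartialHomeomorph_source hD' (by simp), has⟩

/-- Near a point `z₀` with nonvanishing coordinate `i₀`, the function `1 - ‖z‖²` and the coordinates
other than `i₀` form a smooth coordinate system. -/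
theorem exists_sphere_coordinates {q : ℕ} (b z₀ : EuclideanSpace ℝ (Fin q)) {i₀ : Fin q}
    (hz₀ : z₀ i₀ ≠ 0) (r : Fin q) (s : Fin q → Fin q) (hs : ∀ k ≠ i₀, ∃ i ≠ r, s i = k) :
    ∃ e ∈ contDiffGroupoid ∞ (𝓡 q), z₀ ∈ e.source ∧
      ∀ z i, e z i = if i = r then 1 - ‖z‖ ^ 2 else z (s i) - b (s i) := by
  let κ : EuclideanSpace ℝ (Fin q) → EuclideanSpace ℝ (Fin q) := fun z =>
    WithLp.toLp 2 fun i => if i = r then 1 - ‖z‖ ^ 2 else z (s i) - b (s i)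
  have hκi : ∀ i, ContDiff ℝ ∞ fun z => κ z i := by
    intro i
    by_cases hi : i = r
    · simp only [κ, hi, if_true]
      exact contDiff_const.sub (contDiff_norm_sq ℝ)
    · simp only [κ, hi, if_false]
      fun_prop
  have hκ : ContDiff ℝ ∞ κ := contDiff_euclidean.2 hκi
  have hd : ∀ w i, fderiv ℝ κ z₀ w i = fderiv ℝ (fun z => κ z i) z₀ w := by
    intro w i
    have h := (hκ.differentiable (by simp) z₀).hasFDerivAt
    have h' := (EuclideanSpace.proj (𝕜 := ℝ) i).hasFDerivAt.comp z₀ h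
    exact (congrArg (fun L => L w) h'.fderiv).symm
  obtain ⟨e, he, hze, hee⟩ := exists_mem_contDiffGroupoid_of_injective_fderiv (κ := κ) (a := z₀)
    (Filter.Eventually.of_forall fun v => hκ.contDiffAt) (by
      intro w hw
      have hk : ∀ k ≠ i₀, w k = 0 := by
        intro k hk
        obtain ⟨i, hi, rfl⟩ := hs k hk
        have h := hd w i
        rw [hw] at h
        have h2 : HasFDerivAt (fun z => κ z i)
            (EuclideanSpace.proj (s i) : EuclideanSpace ℝ (Fin q) →L[ℝ] ℝ) z₀ := by
          simp only [κ, hi, if_false]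
          exact (EuclideanSpace.proj (𝕜 := ℝ) (s i)).hasFDerivAt.sub_const _
        rw [h2.fderiv] at h
        exact h.symm
      have hr := hd w r
      rw [hw] at hr
      have h2 : HasFDerivAt (fun z => κ z r) (-(2 • innerSL ℝ z₀)) z₀ := by
        simp only [κ, if_true]
        exact (hasStrictFDerivAt_norm_sq z₀).hasFDerivAt.const_sub 1
      rw [h2.fderiv] at hr
      -- A vector in the kernel is orthogonal to `z₀` and supported in the coordinate `i₀`, where
      -- `z₀` does not vanish.
      have hin : inner ℝ z₀ w = 0 := by simpa using hr.symm
      rw [PiLp.inner_apply, Finset.sum_eq_single i₀ (fun k _ hk' => by simp [hk k hk'])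
        (by simp)] at hin
      have hi₀ : w i₀ = 0 := by simpa [hz₀] using hin
      ext k
      by_cases h : k = i₀
      · rw [h, hi₀]; rfl
      · exact hk k h)
  exact ⟨e, he, hze, fun z i => by rw [hee]⟩

/-! ### The closed ball as a manifold with boundary -/

section Disk

variable {q : ℕ} [NeZero q] {W : Type*} [TopologicalSpace W]

/-- Smooth coordinates of `ℝ^q` in which the closed unit ball is the half-space `0 ≤ x₀`. -/
structure IsBallChart (e : OpenPartialHomeomorph (EuclideanSpace ℝ (Fin q))
    (EuclideanSpace ℝ (Fin q))) : Prop where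
  mem_groupoid : e ∈ contDiffGroupoid ∞ (𝓡 q)
  norm_le_one_iff : ∀ z ∈ e.source, ‖z‖ ≤ 1 ↔ 0 ≤ e z 0
  norm_eq_one_iff : ∀ z ∈ e.source, ‖z‖ = 1 ↔ e z 0 = 0

theorem exists_isBallChart (z₀ : EuclideanSpace ℝ (Fin q)) :
    ∃ e, IsBallChart e ∧ z₀ ∈ e.source := by
  by_cases h : z₀ = 0
  -- At the centre, a unit translation makes coordinate `0` positive on the whole open ball, so this
  -- chart misses the boundary.
  · let t : EuclideanSpace ℝ (Fin q) := EuclideanSpace.single 0 1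
    obtain ⟨e, he, hze, hee⟩ := exists_mem_contDiffGroupoid_of_injective_fderiv
      (κ := fun z => z + t) (a := z₀)
      (Filter.Eventually.of_forall fun v => contDiffAt_id.add contDiffAt_const) (by
        intro w hw
        have : HasFDerivAt (fun z => z + t) (ContinuousLinearMap.id ℝ _) z₀ :=
          (hasFDerivAt_id z₀).add_const t
        rwa [this.fderiv] at hw)
    have hb : IsOpen (Metric.ball (0 : EuclideanSpace ℝ (Fin q)) 1) := Metric.isOpen_ball
    have hpos : ∀ z ∈ Metric.ball (0 : EuclideanSpace ℝ (Fin q)) 1, ‖z‖ < 1 ∧ 0 < e z 0 := by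
      intro z hz
      have hz' : ‖z‖ < 1 := by simpa using hz
      refine ⟨hz', ?_⟩
      have h1 := (PiLp.norm_apply_le z 0).trans_lt hz'
      have h2 := (abs_lt.1 h1).1
      simp [hee, t]
      linarith
    refine ⟨e.restr (Metric.ball 0 1), ⟨closedUnderRestriction' he hb, ?_, ?_⟩, ?_⟩
    · intro z hz
      rw [e.restr_source, hb.interior_eq] at hz
      obtain ⟨h1, h2⟩ := hpos z hz.2
      exact iff_of_true h1.le h2.le
    · intro z hz
      rw [e.restr_source, hb.interior_eq] at hz
      obtain ⟨h1, h2⟩ := hpos z hz.2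
      exact iff_of_false h1.ne h2.ne'
    · rw [e.restr_source, hb.interior_eq]
      exact ⟨hze, by simp [h]⟩
  · obtain ⟨i₀, hi₀⟩ : ∃ i, z₀ i ≠ 0 := by
      by_contra! hall
      exact h (by ext i; exact hall i)
    obtain ⟨e, he, hze, hee⟩ := exists_sphere_coordinates 0 z₀ hi₀ 0 (Equiv.swap 0 i₀) (by
      intro k hk
      refine ⟨Equiv.swap 0 i₀ k, ?_, Equiv.swap_apply_self _ _ _⟩
      rw [Ne, ← Equiv.eq_symm_apply]
      simpa using hk)
    refine ⟨e, ⟨he, fun z _ => ?_, fun z _ => ?_⟩, hze⟩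
    · rw [hee, if_pos rfl, sub_nonneg, sq_le_one_iff₀ (norm_nonneg z)]
    · rw [hee, if_pos rfl, sub_eq_zero, eq_comm (a := (1 : ℝ)),
        pow_eq_one_iff_of_nonneg (norm_nonneg z) two_ne_zero]

/-- The chart of a space `W` embedded onto the closed unit ball that is induced by coordinates
adapted to the ball. -/
noncomputable def ballHalfChart [Nonempty W] {ε : W → EuclideanSpace ℝ (Fin q)}
    (hε : Topology.IsEmbedding ε) (hr : Set.range ε = Metric.closedBall 0 1)
    {e : OpenPartialHomeomorph (EuclideanSpace ℝ (Fin q)) (EuclideanSpace ℝ (Fin q))}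
    (he : IsBallChart e) : OpenPartialHomeomorph W (EuclideanHalfSpace q) :=
  have hmem : ∀ w, ‖ε w‖ ≤ 1 := fun w => by
    have : ε w ∈ Metric.closedBall 0 1 := hr ▸ Set.mem_range_self w
    simpa using this
  have hval : ∀ w ∈ ε ⁻¹' e.source, ((𝓡∂ q).symm (e (ε w))).1 = e (ε w) := fun w hw =>
    (𝓡∂ q).right_inv (by
      rw [range_modelWithCornersEuclideanHalfSpace]
      exact (he.norm_le_one_iff _ hw).1 (hmem w))
  have hinv : ∀ x : EuclideanHalfSpace q, x.1 ∈ e.target →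
      ε (Function.invFun ε (e.symm x.1)) = e.symm x.1 := fun x hx =>
    Function.invFun_eq (f := ε) (by
      have : e.symm x.1 ∈ Set.range ε := by
        rw [hr, mem_closedBall_zero_iff, he.norm_le_one_iff _ (e.map_target hx), e.right_inv hx]
        exact x.2
      exact this)
  { toFun := fun w => (𝓡∂ q).symm (e (ε w))
    invFun := fun x => Function.invFun ε (e.symm x.1)
    source := ε ⁻¹' e.source
    target := Subtype.val ⁻¹' e.target
    map_source' := fun w hw => by
      rw [Set.mem_preimage, hval w hw]; exact e.map_source hw
    map_target' := fun x hx => by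
      rw [Set.mem_preimage, hinv x hx]; exact e.map_target hx
    left_inv' := fun w hw => by
      rw [hval w hw, e.left_inv hw, Function.leftInverse_invFun hε.injective]
    right_inv' := fun x hx => by
      rw [hinv x hx, e.right_inv hx]; exact (𝓡∂ q).left_inv x
    open_source := e.open_source.preimage hε.continuous
    open_target := e.open_target.preimage continuous_subtype_val
    continuousOn_toFun := (𝓡∂ q).continuous_symm.comp_continuousOn
      (e.continuousOn.comp hε.continuous.continuousOn fun _ hw => hw)
    continuousOn_invFun := by
      rw [hε.continuousOn_iff]
      exact (e.continuousOn_symm.comp continuous_subtype_val.continuousOn fun _ hx => hx).congr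
        fun x hx => hinv x hx }

theorem ballHalfChart_val [Nonempty W] {ε : W → EuclideanSpace ℝ (Fin q)}
    (hε : Topology.IsEmbedding ε) (hr : Set.range ε = Metric.closedBall 0 1)
    {e : OpenPartialHomeomorph (EuclideanSpace ℝ (Fin q)) (EuclideanSpace ℝ (Fin q))}
    (he : IsBallChart e) {w : W} (hw : ε w ∈ e.source) :
    (ballHalfChart hε hr he w).1 = e (ε w) :=
  (𝓡∂ q).right_inv (by
    have : ε w ∈ Metric.closedBall 0 1 := hr ▸ Set.mem_range_self w
    rw [range_modelWithCornersEuclideanHalfSpace]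
    exact (he.norm_le_one_iff _ hw).1 (by simpa using this))

theorem ballHalfChart_symm [Nonempty W] {ε : W → EuclideanSpace ℝ (Fin q)}
    (hε : Topology.IsEmbedding ε) (hr : Set.range ε = Metric.closedBall 0 1)
    {e : OpenPartialHomeomorph (EuclideanSpace ℝ (Fin q)) (EuclideanSpace ℝ (Fin q))}
    (he : IsBallChart e) {x : EuclideanHalfSpace q} (hx : x.1 ∈ e.target) :
    ε ((ballHalfChart hε hr he).symm x) = e.symm x.1 := by
  have hx' : x ∈ (ballHalfChart hε hr he).target := hx
  have h1 := (ballHalfChart hε hr he).map_target hx'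
  rw [← e.left_inv h1, ← ballHalfChart_val hε hr he h1, (ballHalfChart hε hr he).right_inv hx']

theorem IsBallChart.contDiffOn {e : OpenPartialHomeomorph (EuclideanSpace ℝ (Fin q))
    (EuclideanSpace ℝ (Fin q))} (he : IsBallChart e) : ContDiffOn ℝ ∞ e e.source :=
  contMDiffOn_iff_contDiffOn.1 (contMDiffOn_of_mem_contDiffGroupoid he.mem_groupoid)

theorem IsBallChart.contDiffOn_symm {e : OpenPartialHomeomorph (EuclideanSpace ℝ (Fin q))
    (EuclideanSpace ℝ (Fin q))} (he : IsBallChart e) : ContDiffOn ℝ ∞ e.symm e.target :=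
  contMDiffOn_iff_contDiffOn.1 (contMDiffOn_of_mem_contDiffGroupoid
    ((contDiffGroupoid ∞ (𝓡 q)).symm he.mem_groupoid))

/-- A space embedded onto the closed unit ball is a smooth manifold with boundary such that the
embedding is a diffeomorphism onto the ball. -/
theorem exists_chartedSpace_of_range_eq_closedBall {ε : W → EuclideanSpace ℝ (Fin q)}
    (hε : Topology.IsEmbedding ε) (hr : Set.range ε = Metric.closedBall 0 1) :
    ∃ _ : ChartedSpace (EuclideanHalfSpace q) W, IsManifold (𝓡∂ q) ∞ W ∧ IsDiffeoOntoDisk ε ∧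
      ∀ w, w ∈ (𝓡∂ q).boundary W ↔ ‖ε w‖ = 1 := by
  have hne : Nonempty W := by
    have : (0 : EuclideanSpace ℝ (Fin q)) ∈ Set.range ε := by rw [hr]; simp
    exact ⟨this.choose⟩
  choose e he hze using exists_isBallChart (q := q)
  let cs : ChartedSpace (EuclideanHalfSpace q) W :=
    { atlas := Set.range fun w => ballHalfChart hε hr (he (ε w))
      chartAt := fun w => ballHalfChart hε hr (he (ε w))
      mem_chart_source := fun w => hze (ε w)
      chart_mem_atlas := fun w => Set.mem_range_self w }
  have hman : IsManifold (𝓡∂ q) ∞ W := by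
    refine isManifold_of_contDiffOn _ _ _ ?_
    rintro _ _ ⟨w, rfl⟩ ⟨w', rfl⟩
    set e₁ := e (ε w)
    set e₂ := e (ε w')
    have hsub : ∀ x ∈ (𝓡∂ q).symm ⁻¹' ((ballHalfChart hε hr (he (ε w))).symm ≫ₕ
        ballHalfChart hε hr (he (ε w'))).source ∩ Set.range (𝓡∂ q),
        x ∈ e₁.target ∧ e₁.symm x ∈ e₂.source ∧
        ((𝓡∂ q) ∘ ((ballHalfChart hε hr (he (ε w))).symm ≫ₕ
          ballHalfChart hε hr (he (ε w'))) ∘ (𝓡∂ q).symm) x = e₂ (e₁.symm x) := by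
      rintro x ⟨hx, hxr⟩
      have hval : ((𝓡∂ q).symm x).1 = x := (𝓡∂ q).right_inv hxr
      rw [Set.mem_preimage, OpenPartialHomeomorph.trans_source] at hx
      have h1 : ((𝓡∂ q).symm x).1 ∈ e₁.target := hx.1
      have h2 : ε ((ballHalfChart hε hr (he (ε w))).symm ((𝓡∂ q).symm x)) ∈ e₂.source := hx.2
      have h3 := ballHalfChart_symm hε hr (he (ε w)) h1
      rw [hval] at h1 h3
      rw [h3] at h2
      refine ⟨h1, h2, ?_⟩
      have h4 := ballHalfChart_val hε hr (he (ε w')) (h3 ▸ h2)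
      rw [h3] at h4
      exact h4
    refine ContDiffOn.congr (f := fun x => e₂ (e₁.symm x)) ?_ fun x hx => (hsub x hx).2.2
    exact (he _).contDiffOn.comp ((he _).contDiffOn_symm.mono fun x hx => (hsub x hx).1)
      fun x hx => (hsub x hx).2.1
  refine ⟨cs, hman, ⟨hr, ?_, Function.invFun ε, ?_, Function.leftInverse_invFun hε.injective⟩, ?_⟩
  · intro w
    have hw : w ∈ (chartAt (EuclideanHalfSpace q) w).source := mem_chart_source _ w
    have h1 := contMDiffOn_extChartAt (I := 𝓡∂ q) (n := ∞) (x := w)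
    have h2 : ContMDiffOn (𝓡∂ q) (𝓡 q) ∞ (fun w' => (e (ε w)).symm (extChartAt (𝓡∂ q) w w'))
        (chartAt (EuclideanHalfSpace q) w).source := by
      refine (contMDiffOn_iff_contDiffOn.2 (he (ε w)).contDiffOn_symm).comp h1 fun w' hw' => ?_
      change (ballHalfChart hε hr (he (ε w)) w').1 ∈ (e (ε w)).target
      rw [ballHalfChart_val _ _ _ hw']
      exact (e (ε w)).map_source hw'
    refine (h2.congr fun w' hw' => ?_).contMDiffAt
      ((chartAt (EuclideanHalfSpace q) w).open_source.mem_nhds hw)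
    change _ = (e (ε w)).symm (ballHalfChart hε hr (he (ε w)) w').1
    rw [ballHalfChart_val _ _ _ hw', (e (ε w)).left_inv hw']
  · intro z hz
    obtain ⟨w, rfl⟩ : z ∈ Set.range ε := hr ▸ hz
    have h1 := contMDiffOn_extChartAt_symm (I := 𝓡∂ q) (n := ∞) w
    have hval : ∀ z ∈ Metric.closedBall 0 1 ∩ (e (ε w)).source, ∃ w',
        ε w' = z ∧ w' ∈ (chartAt (EuclideanHalfSpace q) w).source ∧
          extChartAt (𝓡∂ q) w w' = e (ε w) z := by
      rintro z ⟨hz, hze⟩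
      obtain ⟨w', rfl⟩ : z ∈ Set.range ε := hr ▸ hz
      exact ⟨w', rfl, hze, ballHalfChart_val hε hr (he (ε w)) hze⟩
    have h2 : ContMDiffOn (𝓡 q) (𝓡∂ q) ∞ (fun z => (extChartAt (𝓡∂ q) w).symm (e (ε w) z))
        (Metric.closedBall 0 1 ∩ (e (ε w)).source) := by
      refine h1.comp ((contMDiffOn_iff_contDiffOn.2 (he (ε w)).contDiffOn).mono
        Set.inter_subset_right) fun z hz => ?_
      obtain ⟨w', -, hw', hz'⟩ := hval z hz
      rw [Set.mem_preimage, ← hz']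
      exact (extChartAt (𝓡∂ q) w).map_source (by rwa [extChartAt_source])
    have h3 : ContMDiffOn (𝓡 q) (𝓡∂ q) ∞ (Function.invFun ε)
        (Metric.closedBall 0 1 ∩ (e (ε w)).source) := by
      refine h2.congr fun z hz => ?_
      obtain ⟨w', rfl, hw', hz'⟩ := hval z hz
      rw [← hz', (extChartAt (𝓡∂ q) w).left_inv (by rwa [extChartAt_source]),
        Function.leftInverse_invFun hε.injective]
    exact (h3 _ ⟨hz, hze _⟩).mono_of_mem_nhdsWithin
      (Filter.inter_mem self_mem_nhdsWithin
        (mem_nhdsWithin_of_mem_nhds ((e (ε w)).open_source.mem_nhds (hze _))))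
  · intro w
    change (𝓡∂ q).IsBoundaryPoint w ↔ _
    rw [ModelWithCorners.isBoundaryPoint_iff, frontier_range_modelWithCornersEuclideanHalfSpace,
      (he (ε w)).norm_eq_one_iff _ (hze _), ← ballHalfChart_val hε hr (he (ε w)) (hze _)]
    exact eq_comm

end Disk

/-! ### Connected fibres and the Stein space -/

section Fibers

variable {X Y : Type*} [TopologicalSpace X]

/-- If two closed sets cover the preimage, their closed images cover `S` and so meet over a point of
`S`. The connected fibre over that point meets both sets, hence their intersection. -/
theorem IsPreconnected.preimage_of_isClosedMap_of_fibers [TopologicalSpace Y] {k : X → Y} (hk : IsClosedMap k)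
    (hfib : ∀ y, IsPreconnected (k ⁻¹' {y})) {S : Set Y} (hS : IsPreconnected S)
    (hSk : S ⊆ Set.range k) : IsPreconnected (k ⁻¹' S) := by
  rw [isPreconnected_closed_iff]
  rintro t t' ht ht' hcov ⟨x, hxS, hxt⟩ ⟨x', hxS', hxt'⟩
  obtain ⟨y, hyS, ⟨z, hzt, rfl⟩, ⟨z', hzt', hzz'⟩⟩ := isPreconnected_closed_iff.1 hS (k '' t)
    (k '' t') (hk t ht) (hk t' ht')
    (fun y hy => by
      obtain ⟨x, rfl⟩ := hSk hy
      exact (hcov hy).imp (Set.mem_image_of_mem k) (Set.mem_image_of_mem k))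
    ⟨k x, hxS, x, hxt, rfl⟩ ⟨k x', hxS', x', hxt', rfl⟩
  have hsub : k ⁻¹' {k z} ⊆ k ⁻¹' S := fun a ha => by
    rw [Set.mem_preimage, Set.mem_singleton_iff] at ha
    rwa [Set.mem_preimage, ha]
  obtain ⟨a, ha, hat⟩ := isPreconnected_closed_iff.1 (hfib (k z)) t t' ht ht'
    (hsub.trans hcov) ⟨z, rfl, hzt⟩ ⟨z', hzz', hzt'⟩
  exact ⟨a, hsub ha, hat⟩

theorem steinQuot_surjective (k : X → Y) : Function.Surjective (steinQuot k) :=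
  Quotient.mk_surjective

theorem continuous_steinQuot (k : X → Y) : Continuous (steinQuot k) := continuous_quotient_mk'

theorem range_steinBar (k : X → Y) : Set.range (steinBar k) = Set.range k := by
  rw [← (steinQuot_surjective k).range_comp (steinBar k)]
  rfl

/-- The fibres of the quotient map `q_k` are connected. -/
theorem isPreconnected_preimage_steinQuot (k : X → Y) (w : SteinSpace k) :
    IsPreconnected (steinQuot k ⁻¹' {w}) := by
  obtain ⟨x, rfl⟩ := steinQuot_surjective k w
  have : steinQuot k ⁻¹' {steinQuot k x} = connectedComponentIn (k ⁻¹' {k x}) x := by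
    ext x'
    rw [Set.mem_preimage, Set.mem_singleton_iff, eq_comm]
    refine Quotient.eq.trans ⟨fun h => h.2, fun h => ⟨?_, h⟩⟩
    exact (connectedComponentIn_subset _ _ h).symm
  rw [this]
  exact isPreconnected_connectedComponentIn

/-- If the fibres of `k` are connected, then `W_k` is the image of `k`. -/
theorem isEmbedding_steinBar [TopologicalSpace Y] [CompactSpace X] [T2Space Y] {k : X → Y} (hk : Continuous k)
    (hfib : ∀ y, IsPreconnected (k ⁻¹' {y})) : Topology.IsEmbedding (steinBar k) := by
  have hcont : Continuous (steinBar k) := hk.quotient_lift _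
  have hcomp : CompactSpace (SteinSpace k) :=
    ⟨by rw [← (steinQuot_surjective k).range_eq]; exact isCompact_range (continuous_steinQuot k)⟩
  have hinj : Function.Injective (steinBar k) := by
    intro w w' h
    obtain ⟨x, rfl⟩ := steinQuot_surjective k w
    obtain ⟨x', rfl⟩ := steinQuot_surjective k w'
    have hx : k x = k x' := h
    refine Quotient.sound ⟨hx, ?_⟩
    exact (hfib (k x)).subset_connectedComponentIn (x := x) rfl subset_rfl hx.symm
  exact (hcont.isClosedEmbedding hinj).isEmbedding

end Fibers

/-! ### Smooth Stein factorizations through the ball -/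

section

variable {n p : ℕ} {M : Type*} [TopologicalSpace M]
  [ChartedSpace (EuclideanSpace ℝ (Fin n)) M]

/-- A smooth map onto the closed ball with connected fibres whose singular points are the points
over the boundary sphere has the closed ball as its Stein factorization. -/
theorem exists_isSteinSmoothStructure [NeZero p] [CompactSpace M] {k : M → EuclideanSpace ℝ (Fin p)}
    (hk : ContMDiff (𝓡 n) (𝓡 p) ∞ k) (hr : Set.range k = Metric.closedBall 0 1)
    (hfib : ∀ y, IsPreconnected (k ⁻¹' {y})) (hS : ∀ x, x ∈ singularLocus n k ↔ ‖k x‖ = 1) :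
    ∃ _ : ChartedSpace (EuclideanHalfSpace p) (SteinSpace k),
      IsSteinSmoothStructure n k ∧ ∃ Φ : SteinSpace k → EuclideanSpace ℝ (Fin p),
        IsDiffeoOntoDisk Φ := by
  obtain ⟨cs, hman, hdiff, hbd⟩ := exists_chartedSpace_of_range_eq_closedBall
    (isEmbedding_steinBar hk.continuous hfib) ((range_steinBar k).trans hr)
  obtain ⟨Ψ, hΨ, hΨ'⟩ := hdiff.smooth_inverse
  refine ⟨cs, ⟨hman, ?_, ?_, hdiff.smooth, ?_⟩, steinBar k, hdiff⟩
  · have : steinQuot k = Ψ ∘ k := by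
      ext x; exact (hΨ' (steinQuot k x)).symm
    rw [this]
    exact hΨ.comp_contMDiff hk fun x => hr ▸ Set.mem_range_self x
  · ext x
    rw [Set.mem_preimage, hbd, hS]
    rfl
  · intro w
    -- `Ψ` is a left inverse of `steinBar k`, so the chain rule, with the derivative of `Ψ` taken
    -- within the ball, gives a left inverse of the differential.
    have h1 : MDifferentiableWithinAt (𝓡 p) (𝓡∂ p) Ψ (Metric.closedBall 0 1) (steinBar k w) :=
      (hΨ _ (hdiff.range_eq ▸ Set.mem_range_self w)).mdifferentiableWithinAt (by simp)
    have h2 : MDifferentiableAt (𝓡∂ p) (𝓡 p) (steinBar k) w :=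
      hdiff.smooth.mdifferentiableAt (by simp)
    have h3 : HasMFDerivAt (𝓡∂ p) (𝓡∂ p) (Ψ ∘ steinBar k) w
        ((mfderivWithin (𝓡 p) (𝓡∂ p) Ψ (Metric.closedBall 0 1) (steinBar k w)).comp
          (mfderiv (𝓡∂ p) (𝓡 p) (steinBar k) w)) := by
      have := h1.hasMFDerivWithinAt.comp w h2.hasMFDerivAt.hasMFDerivWithinAt (s := Set.univ)
        (fun w' _ => hdiff.range_eq ▸ Set.mem_range_self w')
      exact hasMFDerivWithinAt_univ.1 this
    have h4 : Ψ ∘ steinBar k = id := funext hΨ'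
    rw [h4] at h3
    have h5 := hasMFDerivAt_unique h3 (hasMFDerivAt_id w)
    intro a b hab
    have h6 : ∀ c, mfderivWithin (𝓡 p) (𝓡∂ p) Ψ (Metric.closedBall 0 1) (steinBar k w)
        (mfderiv (𝓡∂ p) (𝓡 p) (steinBar k) w c) = c := fun c => congrArg (fun L => L c) h5
    rw [← h6 a, hab, h6 b]

/-- The surjectivity of the differential can be tested in a chart of the source. -/
theorem surjective_mfderiv_iff_of_mem_maximalAtlas [IsManifold (𝓡 n) ∞ M]
    {k : M → EuclideanSpace ℝ (Fin p)} {x : M} (hk : MDifferentiableAt (𝓡 n) (𝓡 p) k x)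
    {φ : OpenPartialHomeomorph M (EuclideanSpace ℝ (Fin n))}
    (hφ : φ ∈ IsManifold.maximalAtlas (𝓡 n) ∞ M) (hx : x ∈ φ.source) :
    Function.Surjective (mfderiv (𝓡 n) (𝓡 p) k x) ↔
      Function.Surjective (fderiv ℝ (k ∘ φ.symm) (φ x)) := by
  have hφd : φ.MDifferentiable (𝓡 n) (𝓡 n) :=
    ⟨(contMDiffOn_of_mem_maximalAtlas hφ).mdifferentiableOn (by simp),
      (contMDiffOn_symm_of_mem_maximalAtlas hφ).mdifferentiableOn (by simp)⟩
  have h1 : MDifferentiableAt (𝓡 n) (𝓡 p) (k ∘ φ.symm) (φ x) :=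
    MDifferentiableAt.comp _ (by rwa [φ.left_inv hx]) (hφd.mdifferentiableAt_symm (φ.map_source hx))
  have h2 : HasMFDerivAt (𝓡 n) (𝓡 p) ((k ∘ φ.symm) ∘ φ) x _ :=
    h1.hasMFDerivAt.comp x (hφd.mdifferentiableAt hx).hasMFDerivAt
  have h3 : mfderiv (𝓡 n) (𝓡 p) k x = _ := (h2.congr_of_eventuallyEq (by
    filter_upwards [φ.open_source.mem_nhds hx] with x' hx'
    simp [φ.left_inv hx'])).mfderiv
  rw [h3, ← mfderiv_eq_fderiv]
  exact (hφd.mfderiv_surjective hx).of_comp_iff _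

theorem differentiableAt_comp_symm_of_mem_maximalAtlas
    {k : M → EuclideanSpace ℝ (Fin p)} {x : M} (hk : MDifferentiableAt (𝓡 n) (𝓡 p) k x)
    {φ : OpenPartialHomeomorph M (EuclideanSpace ℝ (Fin n))}
    (hφ : φ ∈ IsManifold.maximalAtlas (𝓡 n) ∞ M) (hx : x ∈ φ.source) :
    DifferentiableAt ℝ (k ∘ φ.symm) (φ x) := by
  rw [← mdifferentiableAt_iff_differentiableAt]
  exact MDifferentiableAt.comp _ (by rwa [φ.left_inv hx])
    ((contMDiffAt_symm_of_mem_maximalAtlas hφ (φ.map_source hx)).mdifferentiableAt (by simp))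

/-- Where `‖k x‖ = 1` the function `‖k‖²` is maximal, so the image of the differential is orthogonal
to `k x ≠ 0`. -/
theorem norm_lt_one_of_surjective_mfderiv [IsManifold (𝓡 n) ∞ M]
    {k : M → EuclideanSpace ℝ (Fin p)} {x : M} (hk : MDifferentiableAt (𝓡 n) (𝓡 p) k x)
    (hb : ∀ x, ‖k x‖ ≤ 1) (hx : Function.Surjective (mfderiv (𝓡 n) (𝓡 p) k x)) : ‖k x‖ < 1 := by
  refine (hb x).lt_of_ne fun h1 => ?_
  have hφ := IsManifold.chart_mem_maximalAtlas (I := 𝓡 n) (n := ∞) x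
  have hxs := mem_chart_source (EuclideanSpace ℝ (Fin n)) x
  set φ := chartAt (EuclideanSpace ℝ (Fin n)) x
  rw [surjective_mfderiv_iff_of_mem_maximalAtlas hk hφ hxs] at hx
  have hd := (differentiableAt_comp_symm_of_mem_maximalAtlas hk hφ hxs).hasFDerivAt
  have hkx : (k ∘ φ.symm) (φ x) = k x := by simp [φ.left_inv hxs]
  have hmax : IsLocalMax (fun v => ‖(k ∘ φ.symm) v‖ ^ 2) (φ x) :=
    Filter.Eventually.of_forall fun v => by
      simp only [hkx, h1, one_pow]
      exact pow_le_one₀ (norm_nonneg _) (hb _)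
  have h0 := hmax.hasFDerivAt_eq_zero hd.norm_sq
  obtain ⟨v, hv⟩ := hx (k x)
  have h2 := congrArg (fun L => L v) h0
  simp [φ.left_inv hxs, hv, h1] at h2

/-- The derivative of `g` within the ball is an endomorphism of `ℝ^p`; being surjective it is
injective, and can be cancelled. -/
theorem surjective_mfderiv_of_comp {f h : M → EuclideanSpace ℝ (Fin p)}
    {g : EuclideanSpace ℝ (Fin p) → EuclideanSpace ℝ (Fin p)} {x : M}
    (hh : MDifferentiableAt (𝓡 n) (𝓡 p) h x) (hg : ContDiffOn ℝ ∞ g (Metric.closedBall 0 1))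
    (hmem : ∀ x, h x ∈ Metric.closedBall 0 1) (hfg : ∀ x, f x = g (h x))
    (hsurj : Function.Surjective (mfderiv (𝓡 n) (𝓡 p) f x)) :
    Function.Surjective (mfderiv (𝓡 n) (𝓡 p) h x) := by
  have hg1 : MDifferentiableWithinAt (𝓡 p) (𝓡 p) g (Metric.closedBall 0 1) (h x) :=
    ((contMDiffOn_iff_contDiffOn.2 hg) _ (hmem _)).mdifferentiableWithinAt (by simp)
  have hcomp : HasMFDerivAt (𝓡 n) (𝓡 p) (g ∘ h) x _ :=
    hasMFDerivWithinAt_univ.1 (hg1.hasMFDerivWithinAt.comp x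
      hh.hasMFDerivAt.hasMFDerivWithinAt (s := Set.univ) (fun x' _ => hmem _))
  have hff : g ∘ h = f := funext fun x => (hfg x).symm
  rw [hff] at hcomp
  rw [hcomp.mfderiv] at hsurj
  set A : EuclideanSpace ℝ (Fin p) →L[ℝ] EuclideanSpace ℝ (Fin p) :=
    mfderivWithin (𝓡 p) (𝓡 p) g (Metric.closedBall 0 1) (h x)
  have hA : Function.Surjective A := Function.Surjective.of_comp hsurj
  have hAinj : Function.Injective A := LinearMap.injective_iff_surjective.2 hA
  intro b
  obtain ⟨a, ha⟩ := hsurj (A b)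
  exact ⟨a, hAinj ha⟩

/-- The Stein factorization through a disk, in terms of maps between Euclidean spaces. -/
theorem exists_contDiffOn_comp_eq [NeZero p] [IsManifold (𝓡 n) ∞ M]
    {f : M → EuclideanSpace ℝ (Fin p)}
    [ChartedSpace (EuclideanHalfSpace p) (SteinSpace f)] (hW : IsSteinSmoothStructure n f)
    {Φ : SteinSpace f → EuclideanSpace ℝ (Fin p)} (hΦ : IsDiffeoOntoDisk Φ) :
    ∃ g : EuclideanSpace ℝ (Fin p) → EuclideanSpace ℝ (Fin p),
      ContDiffOn ℝ ∞ g (Metric.closedBall 0 1) ∧ (∀ x, f x = g (Φ (steinQuot f x))) ∧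
      ∀ x, x ∈ singularLocus n f ↔ ‖Φ (steinQuot f x)‖ = 1 := by
  obtain ⟨Ψ, hΨ, hΨ'⟩ := hΦ.smooth_inverse
  have hmem : ∀ w, Φ w ∈ Metric.closedBall 0 1 := fun w => hΦ.range_eq ▸ Set.mem_range_self w
  have hg : ContDiffOn ℝ ∞ (steinBar f ∘ Ψ) (Metric.closedBall 0 1) :=
    contMDiffOn_iff_contDiffOn.1 (hW.smooth_bar.comp_contMDiffOn hΨ)
  have hfg : ∀ x, f x = (steinBar f ∘ Ψ) (Φ (steinQuot f x)) := fun x => by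
    rw [Function.comp_apply, hΨ']; rfl
  refine ⟨steinBar f ∘ Ψ, hg, hfg, fun x => ⟨fun hx => ?_, fun hx hsurj => ?_⟩⟩
  · have hle : ‖Φ (steinQuot f x)‖ ≤ 1 := mem_closedBall_zero_iff.1 (hmem _)
    refine hle.eq_of_not_lt fun hlt => ?_
    have hbd : steinQuot f x ∈ (𝓡∂ p).boundary (SteinSpace f) := by
      rw [← hW.preimage_boundary] at hx; exact hx
    -- Over the open ball `Ψ` is differentiable without restriction, with surjective differential
    -- since `Ψ ∘ Φ = id`. So it takes an interior value, contradicting `hbd`.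
    have hd : MDifferentiableAt (𝓡 p) (𝓡∂ p) Ψ (Φ (steinQuot f x)) :=
      (hΨ.contMDiffAt (Filter.mem_of_superset (Metric.isOpen_ball.mem_nhds
        (mem_ball_zero_iff.2 hlt)) Metric.ball_subset_closedBall)).mdifferentiableAt (by simp)
    have hd' : MDifferentiableAt (𝓡∂ p) (𝓡 p) Φ (steinQuot f x) :=
      hΦ.smooth.mdifferentiableAt (by simp)
    have hcomp := hd.hasMFDerivAt.comp _ hd'.hasMFDerivAt
    have hid : Ψ ∘ Φ = id := funext hΨ'
    rw [hid] at hcomp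
    have huniq := hasMFDerivAt_unique hcomp (hasMFDerivAt_id _)
    have hint := hd.isInteriorPoint_of_surjective_mfderiv
      (fun a => ⟨mfderiv (𝓡∂ p) (𝓡 p) Φ (steinQuot f x) (show EuclideanSpace ℝ (Fin p) from a),
        congrArg (fun L : EuclideanSpace ℝ (Fin p) →L[ℝ] EuclideanSpace ℝ (Fin p) => L a) huniq⟩)
      BoundarylessManifold.isInteriorPoint
    rw [hΨ', ModelWithCorners.isInteriorPoint_iff_not_isBoundaryPoint] at hint
    exact hint hbd
  · have hh : MDifferentiableAt (𝓡 n) (𝓡 p) (Φ ∘ steinQuot f) x :=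
      (hΦ.smooth.comp hW.smooth_quot).mdifferentiableAt (by simp)
    exact (norm_lt_one_of_surjective_mfderiv hh (fun x => mem_closedBall_zero_iff.1 (hmem _))
      (surjective_mfderiv_of_comp hh hg (fun _ => hmem _) hfg hsurj)).ne hx

end

/-! ### Definite folds and the growth of `1 - ‖h‖²` -/

section Fold

variable {n p : ℕ}

/-- The sum of the squares of the coordinates of `ℝ^n` from the `p`-th one on. -/
def tailSq (p : ℕ) {n : ℕ} (v : EuclideanSpace ℝ (Fin n)) : ℝ :=
  ∑ j : Fin n, if (j : ℕ) + 1 < p then 0 else v j ^ 2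

theorem tailSq_eq_zero_iff {v : EuclideanSpace ℝ (Fin n)} :
    tailSq p v = 0 ↔ ∀ j : Fin n, p ≤ (j : ℕ) + 1 → v j = 0 := by
  rw [tailSq, Finset.sum_eq_zero_iff_of_nonneg fun j _ => by split_ifs <;> positivity]
  refine forall_congr' fun j => ?_
  by_cases h : (j : ℕ) + 1 < p
  · simp [h]
  · simp [h, not_lt.1 h]

theorem tailSq_nonneg (v : EuclideanSpace ℝ (Fin n)) : 0 ≤ tailSq p v :=
  Finset.sum_nonneg fun j _ => by split_ifs <;> positivity

theorem tailSq_eq_sum_subtype (v : EuclideanSpace ℝ (Fin n)) :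
    tailSq p v = ∑ j : {j : Fin n // p ≤ (j : ℕ) + 1}, v j ^ 2 := by
  rw [tailSq, ← Finset.sum_subtype (Finset.univ.filter fun j : Fin n => p ≤ (j : ℕ) + 1)
    (fun j => by simp) (fun j => v j ^ 2), Finset.sum_filter]
  refine Finset.sum_congr rfl fun j _ => ?_
  by_cases h : (j : ℕ) + 1 < p
  · simp [h, not_le.2 h]
  · simp [h, not_lt.1 h]

theorem hasFDerivAt_tailSq (v : EuclideanSpace ℝ (Fin n)) :
    HasFDerivAt (tailSq p) (∑ j : Fin n, if (j : ℕ) + 1 < p then 0 else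
      (2 * v j) • (EuclideanSpace.proj j : EuclideanSpace ℝ (Fin n) →L[ℝ] ℝ)) v := by
  refine HasFDerivAt.fun_sum fun j _ => ?_
  split_ifs
  · exact hasFDerivAt_const _ _
  · have := ((EuclideanSpace.proj (𝕜 := ℝ) j).hasFDerivAt (x := v)).pow 2
    simpa using this

variable {M : Type*} [TopologicalSpace M] [ChartedSpace (EuclideanSpace ℝ (Fin n)) M]

/-- Charts `φ`, `ψ` in which `f` is the definite fold `(x', x'') ↦ (x', σ ‖x''‖²)` around `x`. -/
structure IsDefiniteFoldChart (f : M → EuclideanSpace ℝ (Fin p)) (x : M)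
    (φ : OpenPartialHomeomorph M (EuclideanSpace ℝ (Fin n)))
    (ψ : OpenPartialHomeomorph (EuclideanSpace ℝ (Fin p)) (EuclideanSpace ℝ (Fin p)))
    (σ : ℝ) : Prop where
  source_mem : φ ∈ IsManifold.maximalAtlas (𝓡 n) ∞ M
  target_mem : ψ ∈ IsManifold.maximalAtlas (𝓡 p) ∞ (EuclideanSpace ℝ (Fin p))
  mem_source : x ∈ φ.source
  map_eq_zero : φ x = 0
  mapsTo : Set.MapsTo f φ.source ψ.source
  sq_eq_one : σ ^ 2 = 1
  head : ∀ z ∈ φ.source, ∀ (i : Fin p) (j : Fin n), (i : ℕ) = j → (i : ℕ) + 1 < p →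
    ψ (f z) i = φ z j
  last : ∀ z ∈ φ.source, ∀ i : Fin p, (i : ℕ) + 1 = p → ψ (f z) i = σ * tailSq p (φ z)

/-- Maximal absolute index forces `l = 0` or `l = n + 1 - p`: all squares carry one common sign,
recorded by `σ`. -/
theorem IsDefiniteFoldPoint.exists_chart {f : M → EuclideanSpace ℝ (Fin p)} {x : M}
    (h : IsDefiniteFoldPoint n f x) : ∃ (φ : OpenPartialHomeomorph M (EuclideanSpace ℝ (Fin n))) (ψ : _)
      (σ : ℝ), IsDefiniteFoldChart f x φ ψ σ := by
  obtain ⟨l, ⟨hl, φ, hφ, ψ, hψ, hx, hx0, hmaps, hform⟩, hmax⟩ := h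
  have hl' : l = n + 1 - p ∨ l = 0 := by omega
  refine ⟨φ, ψ, if l = 0 then -1 else 1, hφ, hψ, hx, hx0, hmaps, by split_ifs <;> norm_num,
    fun z hz => (hform z hz).1, fun z hz i hi => ?_⟩
  rw [(hform z hz).2 i hi, tailSq, Finset.mul_sum]
  refine Finset.sum_congr rfl fun j _ => ?_
  have hj := j.2
  by_cases h1 : (j : ℕ) + 1 < p
  · simp [h1]
  · rcases eq_or_ne l 0 with h0 | h0
    · simp [h0, h1]
    · have h2 : (j : ℕ) + 1 < p + l := by omega
      simp [h0, h1, h2]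

variable {f h : M → EuclideanSpace ℝ (Fin p)}
  {g : EuclideanSpace ℝ (Fin p) → EuclideanSpace ℝ (Fin p)}
  {x : M} {φ : OpenPartialHomeomorph M (EuclideanSpace ℝ (Fin n))}
  {ψ : OpenPartialHomeomorph (EuclideanSpace ℝ (Fin p)) (EuclideanSpace ℝ (Fin p))} {σ : ℝ}

/-- In fold coordinates the differential is the identity on the first `p - 1` coordinates, and its
last component is `2σ` times the pairing with the transverse part of `φ z`. -/
theorem mem_singularLocus_iff_tailSq [IsManifold (𝓡 n) ∞ M] (hp : 1 ≤ p) (hpn : p < n)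
    (hf : ContMDiff (𝓡 n) (𝓡 p) ∞ f)
    (hc : IsDefiniteFoldChart f x φ ψ σ) {z : M} (hz : z ∈ φ.source) :
    z ∈ singularLocus n f ↔ tailSq p (φ z) = 0 := by
  have hσ : σ ≠ 0 := fun h => by have := hc.sq_eq_one; simp [h] at this
  have hfd : MDifferentiableAt (𝓡 n) (𝓡 p) f z := hf.mdifferentiableAt (by simp)
  have hd := (differentiableAt_comp_symm_of_mem_maximalAtlas hfd hc.source_mem hz).hasFDerivAt
  have hψd : ψ.MDifferentiable (𝓡 p) (𝓡 p) :=
    ⟨(contMDiffOn_of_mem_maximalAtlas hc.target_mem).mdifferentiableOn (by simp),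
      (contMDiffOn_symm_of_mem_maximalAtlas hc.target_mem).mdifferentiableOn (by simp)⟩
  have hψb := hψd.mfderiv_bijective (hc.mapsTo hz)
  have hψf := (mdifferentiableAt_iff_differentiableAt.1
    (hψd.mdifferentiableAt (hc.mapsTo hz))).hasFDerivAt
  rw [mfderiv_eq_fderiv] at hψb
  have hfz : (f ∘ φ.symm) (φ z) = f z := by simp [φ.left_inv hz]
  rw [← hfz] at hψb hψf
  have hF := hψf.comp _ hd
  set F' := (fderiv ℝ ψ ((f ∘ φ.symm) (φ z))).comp (fderiv ℝ (f ∘ φ.symm) (φ z)) with hF'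
  have hFi : ∀ i, HasFDerivAt (fun v => ψ (f (φ.symm v)) i)
      ((EuclideanSpace.proj i : EuclideanSpace ℝ (Fin p) →L[ℝ] ℝ).comp F') (φ z) := fun i =>
    (EuclideanSpace.proj (𝕜 := ℝ) i).hasFDerivAt.comp _ hF
  have hnear : ∀ᶠ v in 𝓝 (φ z), v ∈ φ.target := φ.open_target.mem_nhds (φ.map_source hz)
  have hhead : ∀ (i : Fin p) (j : Fin n), (i : ℕ) = j → (i : ℕ) + 1 < p → ∀ a, F' a i = a j := by
    intro i j hij hi a
    have h1 := (hFi i).congr_of_eventuallyEq (f₁ := fun v : EuclideanSpace ℝ (Fin n) => v j) (by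
      filter_upwards [hnear] with v hv
      rw [hc.head _ (φ.map_target hv) i j hij hi, φ.right_inv hv])
    have h2 := h1.unique (EuclideanSpace.proj (𝕜 := ℝ) j).hasFDerivAt
    exact congrArg (fun L => L a) h2
  have hlast : ∀ i : Fin p, (i : ℕ) + 1 = p → ∀ a, F' a i =
      σ * ∑ j : Fin n, if (j : ℕ) + 1 < p then 0 else 2 * φ z j * a j := by
    intro i hi a
    have h1 := (hFi i).congr_of_eventuallyEq
      (f₁ := fun v : EuclideanSpace ℝ (Fin n) => σ * tailSq p v) (by
      filter_upwards [hnear] with v hv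
      rw [hc.last _ (φ.map_target hv) i hi, φ.right_inv hv])
    have h2 := h1.unique ((hasFDerivAt_tailSq (φ z)).const_mul σ)
    have h3 := congrArg (fun L => L a) h2
    refine h3.trans ?_
    simp only [_root_.smul_apply, _root_.sum_apply, smul_eq_mul]
    congr 1
    refine Finset.sum_congr rfl fun j _ => ?_
    split_ifs <;> simp
  have hiff : z ∈ singularLocus n f ↔ ¬ Function.Surjective F' := by
    rw [singularLocus, Set.mem_ofPred_eq,
      surjective_mfderiv_iff_of_mem_maximalAtlas hfd hc.source_mem hz, not_iff_not, hF',
      ContinuousLinearMap.coe_comp]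
    exact (Function.Surjective.of_comp_iff' hψb _).symm
  rw [hiff, not_iff_comm]
  constructor
  · intro h0 b
    let l : Fin p := ⟨p - 1, by omega⟩
    -- The transverse part is the multiple of that of `φ z` on which the last component takes the
    -- value `b l`.
    refine ⟨WithLp.toLp 2 fun j => if hj : (j : ℕ) + 1 < p then b ⟨j, by omega⟩ else
      b l / (2 * σ * tailSq p (φ z)) * φ z j, ?_⟩
    ext i
    by_cases hi : (i : ℕ) + 1 < p
    · rw [hhead i ⟨i, by omega⟩ rfl hi]
      simp [hi]
    · have hil : i = l := Fin.ext (by simp only [l]; omega)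
      rw [hlast i (by omega), hil]
      have : (∑ j : Fin n, if (j : ℕ) + 1 < p then 0 else 2 * φ z j *
          (WithLp.toLp 2 fun j : Fin n => if hj : (j : ℕ) + 1 < p then b ⟨j, by omega⟩ else
            b l / (2 * σ * tailSq p (φ z)) * φ z j : EuclideanSpace ℝ (Fin n)) j) =
          2 * (b l / (2 * σ * tailSq p (φ z))) * tailSq p (φ z) := by
        conv_rhs => rw [tailSq, Finset.mul_sum]
        refine Finset.sum_congr rfl fun j _ => ?_
        split_ifs with hj
        · simp
        · simp only [hj, dite_false, tailSq]
          ring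
      rw [this]
      field_simp
  · intro hsurj h0
    let l : Fin p := ⟨p - 1, by omega⟩
    obtain ⟨a, ha⟩ := hsurj (EuclideanSpace.single l 1)
    have h1 := hlast l (by simp only [l]; omega) a
    rw [ha, Finset.sum_eq_zero, mul_zero] at h1
    · simp at h1
    · intro j _
      split_ifs with hj
      · rfl
      · rw [tailSq_eq_zero_iff.1 h0 j (by omega)]; ring

/-- Inside the fold chart `x` is alone in its fibre of `f`, hence isolated in its fibre of `h`,
which is connected. -/
theorem IsDefiniteFoldChart.eq_of_map_eq [T1Space M] (hp : 1 ≤ p)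
    (hfib : ∀ y, IsPreconnected (h ⁻¹' {y})) (hfg : ∀ x, f x = g (h x))
    (hc : IsDefiniteFoldChart f x φ ψ σ) {z : M} (hz : h z = h x) : z = x := by
  have hσ : σ ≠ 0 := fun h => by have := hc.sq_eq_one; simp [h] at this
  have hloc : ∀ z ∈ φ.source, h z = h x → z = x := by
    intro z hzs hz
    have hfz : f z = f x := by rw [hfg, hfg, hz]
    refine φ.injOn hzs hc.mem_source ?_
    rw [hc.map_eq_zero]
    ext j
    by_cases hj : (j : ℕ) + 1 < p
    · have h1 := hc.head z hzs ⟨j, by omega⟩ j rfl hj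
      have h2 := hc.head x hc.mem_source ⟨j, by omega⟩ j rfl hj
      rw [← h1, hfz, h2, hc.map_eq_zero]
    · let l : Fin p := ⟨p - 1, by omega⟩
      have hl : (l : ℕ) + 1 = p := by simp only [l]; omega
      have h1 := hc.last z hzs l hl
      have h2 := hc.last x hc.mem_source l hl
      rw [hfz, h2, mul_right_inj' hσ] at h1
      have h3 : tailSq p (φ z) = 0 := by
        rw [← h1, tailSq_eq_zero_iff, hc.map_eq_zero]; simp
      exact tailSq_eq_zero_iff.1 h3 j (by omega)
  by_contra hne
  obtain ⟨w, hw, hwU, hwx⟩ := hfib (h x) φ.source {x}ᶜ φ.open_source isOpen_compl_singleton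
    (fun w _ => by
      by_cases hw : w = x
      · exact Or.inl (hw ▸ hc.mem_source)
      · exact Or.inr hw)
    ⟨x, rfl, hc.mem_source⟩ ⟨z, hz, hne⟩
  exact hwx (hloc w hwU hw)

theorem IsClosedMap.exists_nhds_preimage_subset {X Y : Type*} [TopologicalSpace X]
    [TopologicalSpace Y] {k : X → Y} (hk : IsClosedMap k) {x : X}
    (hx : ∀ z, k z = k x → z = x) {U : Set X} (hU : U ∈ 𝓝 x) :
    ∃ V ∈ 𝓝 (k x), k ⁻¹' V ⊆ U := by
  obtain ⟨U', hU', hUo, hxU⟩ := mem_nhds_iff.1 hU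
  refine ⟨(k '' U'ᶜ)ᶜ, (hk _ hUo.isClosed_compl).isOpen_compl.mem_nhds ?_, fun z hz => hU' ?_⟩
  · rintro ⟨z, hz, hzx⟩
    exact hz (hx z hzx ▸ hxU)
  · by_contra hzU
    exact hz ⟨z, hzU, rfl⟩

/-- The last fold coordinate is `G ∘ h` with `G` Lipschitz near `h x`. Compare `h m` with its radial
projection to the sphere: that is the image of a singular point, which lies in the fold chart
because the fibre over `h x` is `{x}` and `h` is closed. So `G` vanishes there. -/
theorem IsDefiniteFoldChart.exists_quadratic_growth [IsManifold (𝓡 n) ∞ M] [CompactSpace M]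
    [T1Space M] (hp : 1 ≤ p) (hpn : p < n) (hf : ContMDiff (𝓡 n) (𝓡 p) ∞ f) (hh : Continuous h)
    (hr : Set.range h = Metric.closedBall 0 1) (hfib : ∀ y, IsPreconnected (h ⁻¹' {y}))
    (hg : ContDiffOn ℝ ∞ g (Metric.closedBall 0 1)) (hfg : ∀ x, f x = g (h x))
    (hS : ∀ x, x ∈ singularLocus n f ↔ ‖h x‖ = 1) (hc : IsDefiniteFoldChart f x φ ψ σ)
    (hx : ‖h x‖ = 1) :
    ∃ c > 0, ∀ᶠ m in 𝓝 x, c * tailSq p (φ m) ≤ 1 - ‖h m‖ ^ 2 := by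
  have hmem : ∀ m, h m ∈ Metric.closedBall 0 1 := fun m => hr ▸ Set.mem_range_self m
  have hσ : |σ| = 1 := by
    have := hc.sq_eq_one
    rwa [← sq_abs, pow_eq_one_iff_of_nonneg (abs_nonneg σ) two_ne_zero] at this
  let l : Fin p := ⟨p - 1, by omega⟩
  have hl : (l : ℕ) + 1 = p := by simp only [l]; omega
  let G : EuclideanSpace ℝ (Fin p) → ℝ := fun y => ψ (g y) l
  have hGf : ∀ m ∈ φ.source, G (h m) = σ * tailSq p (φ m) := fun m hm => by
    rw [← hc.last m hm l hl, hfg]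
  have hG : ContDiffWithinAt ℝ 1 G (Metric.closedBall 0 1) (h x) := by
    have h1 : ContDiffAt ℝ ∞ ψ (g (h x)) := by
      rw [← hfg, ← contMDiffAt_iff_contDiffAt]
      exact contMDiffAt_of_mem_maximalAtlas hc.target_mem (hc.mapsTo hc.mem_source)
    have h2 := h1.comp_contDiffWithinAt (h x) (hg _ (hmem x))
    exact (((EuclideanSpace.proj (𝕜 := ℝ) l).contDiff.contDiffAt (n := ∞)
      ).comp_contDiffWithinAt (h x) h2).of_le (WithTop.coe_le_coe.2 le_top)
  obtain ⟨K, t, ht, hK⟩ := hG.exists_lipschitzOnWith (convex_closedBall 0 1)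
  obtain ⟨V, hV, hVφ⟩ := hh.isClosedMap.exists_nhds_preimage_subset
    (fun z hz => hc.eq_of_map_eq hp hfib hfg hz) (φ.open_source.mem_nhds hc.mem_source)
  have hne : h x ≠ 0 := fun h0 => by simp [h0] at hx
  let N : EuclideanSpace ℝ (Fin p) → EuclideanSpace ℝ (Fin p) := fun y => ‖y‖⁻¹ • y
  have hNx : N (h x) = h x := by simp [N, hx]
  have hNmem : ∀ y, N y ∈ Metric.closedBall (0 : EuclideanSpace ℝ (Fin p)) 1 := fun y => by
    rw [mem_closedBall_zero_iff, norm_smul, norm_inv, norm_norm]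
    exact inv_mul_le_one
  have hN : Filter.Tendsto (fun m => N (h m)) (𝓝 x) (𝓝[Metric.closedBall 0 1] (h x)) := by
    refine tendsto_nhdsWithin_iff.2 ⟨?_, Filter.Eventually.of_forall fun m => hNmem _⟩
    have : ContinuousAt N (h x) :=
      (continuousAt_id.norm.inv₀ (norm_ne_zero_iff.2 hne)).smul continuousAt_id
    have h2 := this.tendsto.comp hh.continuousAt.tendsto
    rwa [hNx] at h2
  have hhx : Filter.Tendsto h (𝓝 x) (𝓝[Metric.closedBall 0 1] (h x)) :=
    tendsto_nhdsWithin_iff.2 ⟨hh.continuousAt, Filter.Eventually.of_forall hmem⟩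
  -- The Lipschitz estimate gives `tailSq ≤ K (1 - ‖h‖)`, and `1 - ‖h‖ ≤ 1 - ‖h‖²`; adding `1`
  -- covers `K = 0`.
  refine ⟨((K : ℝ) + 1)⁻¹, by positivity, ?_⟩
  filter_upwards [hhx.eventually ht, hN.eventually ht,
    (hN.mono_right nhdsWithin_le_nhds).eventually hV, φ.open_source.mem_nhds hc.mem_source,
    hh.continuousAt.eventually_ne hne] with m h1 h2 h3 h4 h5
  obtain ⟨m', hm'⟩ : N (h m) ∈ Set.range h := hr ▸ hNmem _
  have hm's : m' ∈ φ.source := hVφ (by rw [Set.mem_preimage, hm']; exact h3)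
  have hG0 : G (N (h m)) = 0 := by
    have hnorm : ‖h m'‖ = 1 := by
      rw [hm', norm_smul, norm_inv, norm_norm, inv_mul_cancel₀ (norm_ne_zero_iff.2 h5)]
    have := (mem_singularLocus_iff_tailSq hp hpn hf hc hm's).1 ((hS m').2 hnorm)
    rw [← hm', hGf m' hm's, this, mul_zero]
  have hle : ‖h m‖ ≤ 1 := mem_closedBall_zero_iff.1 (hmem m)
  have hdist : dist (h m) (N (h m)) = 1 - ‖h m‖ := by
    have : h m - N (h m) = (1 - ‖h m‖⁻¹) • h m := by rw [sub_smul, one_smul]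
    rw [dist_eq_norm, this, norm_smul, Real.norm_eq_abs, abs_of_nonpos, neg_sub, sub_mul,
      inv_mul_cancel₀ (norm_ne_zero_iff.2 h5), one_mul]
    rw [sub_nonpos]
    exact (one_le_inv₀ (norm_pos_iff.2 h5)).2 hle
  have hL := hK.dist_le_mul _ h1 _ h2
  rw [hG0, hdist, hGf m h4, Real.dist_eq, sub_zero, abs_mul, hσ, one_mul,
    abs_of_nonneg (tailSq_nonneg _)] at hL
  rw [inv_mul_le_iff₀ (by positivity)]
  have hK0 : (0 : ℝ) ≤ K := K.2
  nlinarith [norm_nonneg (h m), mul_nonneg (norm_nonneg (h m)) (sub_nonneg.2 hle),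
    mul_nonneg hK0 (mul_nonneg (norm_nonneg (h m)) (sub_nonneg.2 hle))]

theorem contDiffOn_comp_symm_of_mem_maximalAtlas {k : M → EuclideanSpace ℝ (Fin p)}
    (hk : ContMDiff (𝓡 n) (𝓡 p) ∞ k) (hφ : φ ∈ IsManifold.maximalAtlas (𝓡 n) ∞ M) :
    ContDiffOn ℝ ∞ (k ∘ φ.symm) φ.target :=
  contMDiffOn_iff_contDiffOn.1 (hk.comp_contMDiffOn (contMDiffOn_symm_of_mem_maximalAtlas hφ))

/-- Around a definite fold point, `1 - ‖h‖²` is a sum of squares of functions that are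
coordinates in the directions transverse to the singular locus. -/
theorem IsDefiniteFoldChart.exists_eq_sum_sq [IsManifold (𝓡 n) ∞ M] [CompactSpace M]
    [T1Space M] (hp : 1 ≤ p) (hpn : p < n) (hf : ContMDiff (𝓡 n) (𝓡 p) ∞ f)
    (hh : ContMDiff (𝓡 n) (𝓡 p) ∞ h)
    (hr : Set.range h = Metric.closedBall 0 1) (hfib : ∀ y, IsPreconnected (h ⁻¹' {y}))
    (hg : ContDiffOn ℝ ∞ g (Metric.closedBall 0 1)) (hfg : ∀ x, f x = g (h x))
    (hS : ∀ x, x ∈ singularLocus n f ↔ ‖h x‖ = 1) (hc : IsDefiniteFoldChart f x φ ψ σ)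
    (hx : ‖h x‖ = 1) :
    ∃ u : EuclideanSpace ℝ (Fin n) → {j : Fin n // p ≤ (j : ℕ) + 1} → ℝ,
      (∀ᶠ v in 𝓝 0, ContDiffAt ℝ ∞ u v) ∧
      (∀ᶠ v in 𝓝 0, 1 - ‖h (φ.symm v)‖ ^ 2 = ∑ j, u v j ^ 2) ∧ u 0 = 0 ∧
      ∀ a, fderiv ℝ u 0 a = 0 → fderiv ℝ (h ∘ φ.symm) 0 a = 0 → a = 0 := by
  have hmem : ∀ m, h m ∈ Metric.closedBall 0 1 := fun m => hr ▸ Set.mem_range_self m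
  have h0t : (0 : EuclideanSpace ℝ (Fin n)) ∈ φ.target := by
    rw [← hc.map_eq_zero]; exact φ.map_source hc.mem_source
  have h0x : φ.symm 0 = x := by rw [← hc.map_eq_zero, φ.left_inv hc.mem_source]
  have hH := contDiffOn_comp_symm_of_mem_maximalAtlas hh hc.source_mem
  obtain ⟨c, hc0, hgrow⟩ := hc.exists_quadratic_growth hp hpn hf hh.continuous hr hfib hg hfg hS hx
  obtain ⟨ρ, hρ0, hρ⟩ := Metric.nhds_basis_closedBall.mem_iff.1 (φ.open_target.mem_nhds h0t)
  -- The cutoff turns the locally defined `1 - ‖h‖²` into a globally smooth function, still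
  -- nonnegative and zero on the kernel of `ϖ`.
  let χ : ContDiffBump (0 : EuclideanSpace ℝ (Fin n)) := ⟨ρ / 2, ρ, half_pos hρ0, half_lt_self hρ0⟩
  let R₀ : EuclideanSpace ℝ (Fin n) → ℝ := fun v => 1 - ‖h (φ.symm v)‖ ^ 2
  have hR₀ : ContDiffOn ℝ ∞ R₀ φ.target := contDiffOn_const.sub (hH.norm_sq ℝ)
  let R : EuclideanSpace ℝ (Fin n) → ℝ := fun v => χ v * R₀ v
  have hR : ContDiff ℝ ∞ R := by
    refine contDiff_iff_contDiffAt.2 fun v => ?_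
    by_cases hv : v ∈ Metric.closedBall 0 ρ
    · exact χ.contDiffAt.mul (hR₀.contDiffAt (φ.open_target.mem_nhds (hρ hv)))
    · refine (contDiffAt_const (c := (0 : ℝ))).congr_of_eventuallyEq ?_
      filter_upwards [Metric.isClosed_closedBall.isOpen_compl.mem_nhds hv] with w hw
      have : χ w = 0 := χ.zero_of_le_dist (by
        have : ¬ dist w 0 ≤ ρ := hw
        exact (not_le.1 this).le)
      simp [R, this]
  let ϖ : EuclideanSpace ℝ (Fin n) →L[ℝ] ({j : Fin n // p ≤ (j : ℕ) + 1} → ℝ) :=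
    ContinuousLinearMap.pi fun j => EuclideanSpace.proj (j : Fin n)
  let ι : ({j : Fin n // p ≤ (j : ℕ) + 1} → ℝ) →L[ℝ] EuclideanSpace ℝ (Fin n) :=
    LinearMap.toContinuousLinearMap
      { toFun := fun a => WithLp.toLp 2 fun j => if hj : p ≤ (j : ℕ) + 1 then a ⟨j, hj⟩ else 0
        map_add' := fun a b => by ext j; by_cases hj : p ≤ (j : ℕ) + 1 <;> simp [hj]
        map_smul' := fun r a => by ext j; by_cases hj : p ≤ (j : ℕ) + 1 <;> simp [hj] }
  have hϖ : ∀ v, ∑ j, ϖ v j ^ 2 = tailSq p v := fun v => (tailSq_eq_sum_subtype v).symm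
  have hRR₀ : ∀ᶠ v in 𝓝 0, R v = R₀ v := by
    filter_upwards [χ.eventuallyEq_one] with v hv
    simp [R, hv]
  obtain ⟨u, hu, hu', hu0, hud⟩ := exists_eq_sum_sq_of_quadratic_growth ϖ ι
    (fun a => by ext j; simp [ϖ, ι, j.2]) hR
    (fun v => mul_nonneg χ.nonneg (sub_nonneg.2 (pow_le_one₀ (norm_nonneg _)
      (mem_closedBall_zero_iff.1 (hmem _)))))
    (fun v hv => by
      by_cases hvρ : v ∈ Metric.closedBall 0 ρ
      · have hvt := hρ hvρ
        have hz : tailSq p (φ (φ.symm v)) = 0 := by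
          rw [φ.right_inv hvt, ← hϖ, hv]; simp
        have hz' := (hS _).1 ((mem_singularLocus_iff_tailSq hp hpn hf hc (φ.map_target hvt)).2 hz)
        simp [R, R₀, hz']
      · have : χ v = 0 := χ.zero_of_le_dist (by
          have : ¬ dist v 0 ≤ ρ := hvρ
          exact (not_le.1 this).le)
        simp [R, this]) hc0 (by
      have htend : Filter.Tendsto φ.symm (𝓝 0) (𝓝 x) := by
        have := (φ.continuousAt_symm h0t).tendsto
        rwa [h0x] at this
      filter_upwards [htend.eventually hgrow, hRR₀, φ.open_target.mem_nhds h0t] with v h1 h2 h3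
      rw [h2, hϖ]
      rwa [φ.right_inv h3] at h1)
  refine ⟨u, hu, ?_, hu0, fun a ha hHa => ?_⟩
  · filter_upwards [hu', hRR₀] with v h1 h2
    rw [← h1, h2]
  · have hϖa := hud a ha
    ext j
    by_cases hj : p ≤ (j : ℕ) + 1
    · exact congrFun hϖa ⟨j, hj⟩
    -- The other coordinates are functions of `h`, namely `ψ ∘ g ∘ h` in index `i`, so they are
    -- killed along with the differential of `h`.
    · let i : Fin p := ⟨j, by omega⟩
      have hψ : DifferentiableAt ℝ ψ (g (h x)) := by
        rw [← hfg, ← mdifferentiableAt_iff_differentiableAt]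
        exact (contMDiffAt_of_mem_maximalAtlas hc.target_mem
          (hc.mapsTo hc.mem_source)).mdifferentiableAt (by simp)
      have hGd : DifferentiableWithinAt ℝ (fun y => ψ (g y)) (Metric.closedBall 0 1)
          ((h ∘ φ.symm) 0) := by
        rw [Function.comp_apply, h0x]
        exact hψ.comp_differentiableWithinAt (h x)
          ((hg _ (hmem x)).differentiableWithinAt (by simp))
      have hHd : DifferentiableAt ℝ (h ∘ φ.symm) 0 :=
        (hH.contDiffAt (φ.open_target.mem_nhds h0t)).differentiableAt (by simp)
      have h1 : HasFDerivAt (fun v => ψ (g (h (φ.symm v)))) _ 0 :=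
        hGd.hasFDerivWithinAt.comp_hasFDerivAt 0 hHd.hasFDerivAt
          (Filter.Eventually.of_forall fun v => hmem _)
      have h2 := (EuclideanSpace.proj (𝕜 := ℝ) i).hasFDerivAt.comp 0 h1
      have h3 := h2.congr_of_eventuallyEq (f₁ := fun v : EuclideanSpace ℝ (Fin n) => v j) (by
        filter_upwards [φ.open_target.mem_nhds h0t] with v hv
        have := hc.head _ (φ.map_target hv) i j rfl (by simp only [i]; omega)
        rw [φ.right_inv hv, hfg] at this
        exact this.symm)
      have h4 := congrArg (fun L => L a)
        (h3.unique (EuclideanSpace.proj (𝕜 := ℝ) j).hasFDerivAt)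
      simp [hHa] at h4
      exact h4.symm

end Fold

/-! ### Charts adapted to `h` over the boundary sphere -/

section Adapted

variable {n p : ℕ} {M : Type*} [TopologicalSpace M] [ChartedSpace (EuclideanSpace ℝ (Fin n)) M]

theorem trans_mem_maximalAtlas [IsManifold (𝓡 n) ∞ M]
    {φ : OpenPartialHomeomorph M (EuclideanSpace ℝ (Fin n))}
    (hφ : φ ∈ IsManifold.maximalAtlas (𝓡 n) ∞ M)
    {e : OpenPartialHomeomorph (EuclideanSpace ℝ (Fin n)) (EuclideanSpace ℝ (Fin n))}
    (he : e ∈ contDiffGroupoid ∞ (𝓡 n)) : φ ≫ₕ e ∈ IsManifold.maximalAtlas (𝓡 n) ∞ M := by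
  refine OpenPartialHomeomorph.mem_maximalAtlas_of_contMDiffOn _ ?_ ?_
  · exact (contMDiffOn_of_mem_contDiffGroupoid he).comp
      ((contMDiffOn_of_mem_maximalAtlas hφ).mono (by simp)) (by
        intro x hx; rw [OpenPartialHomeomorph.trans_source] at hx; exact hx.2)
  · exact (contMDiffOn_symm_of_mem_maximalAtlas hφ).comp
      ((contMDiffOn_of_mem_contDiffGroupoid ((contDiffGroupoid ∞ (𝓡 n)).symm he)).mono (by
        intro x hx; rw [OpenPartialHomeomorph.trans_target] at hx; exact hx.1)) (by
        intro x hx; rw [OpenPartialHomeomorph.trans_target] at hx; exact hx.2)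

/-- Charts of `M` in which the coordinates of `h` with indices `s 0, …, s (p - 2)` are the first
coordinates, and `1 - ‖h‖²` is the sum of the squares of the others. -/
structure IsAdaptedChart (h : M → EuclideanSpace ℝ (Fin p)) (s : Fin n → Fin p) (x : M)
    (χ : OpenPartialHomeomorph M (EuclideanSpace ℝ (Fin n))) : Prop where
  mem_maximalAtlas : χ ∈ IsManifold.maximalAtlas (𝓡 n) ∞ M
  mem_source : x ∈ χ.source
  map_eq_zero : χ x = 0
  head : ∀ z ∈ χ.source, ∀ j : Fin n, (j : ℕ) + 1 < p → χ z j = h z (s j) - h x (s j)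
  tail : ∀ z ∈ χ.source, tailSq p (χ z) = 1 - ‖h z‖ ^ 2

/-- The functions `u` and the coordinates of `h` other than `i₀` have jointly injective
differential: maximality of `‖h‖²` at `x` gives one more linear relation, which recovers the
coordinate `i₀` because `h x i₀ ≠ 0`. -/
theorem exists_isAdaptedChart [IsManifold (𝓡 n) ∞ M] [CompactSpace M] [T1Space M]
    {f h : M → EuclideanSpace ℝ (Fin p)} {g : EuclideanSpace ℝ (Fin p) → EuclideanSpace ℝ (Fin p)}
    (hpn : p < n) (hf : IsSpecialGeneric n f) (hh : ContMDiff (𝓡 n) (𝓡 p) ∞ h)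
    (hr : Set.range h = Metric.closedBall 0 1) (hfib : ∀ y, IsPreconnected (h ⁻¹' {y}))
    (hg : ContDiffOn ℝ ∞ g (Metric.closedBall 0 1)) (hfg : ∀ x, f x = g (h x))
    (hS : ∀ x, x ∈ singularLocus n f ↔ ‖h x‖ = 1) {x : M} (hx : ‖h x‖ = 1) {i₀ : Fin p}
    (hi₀ : h x i₀ ≠ 0) {s : Fin n → Fin p}
    (hs : ∀ k ≠ i₀, ∃ j : Fin n, (j : ℕ) + 1 < p ∧ s j = k) :
    ∃ χ, IsAdaptedChart h s x χ := by
  obtain ⟨φ, ψ, σ, hc⟩ := (hf.definite x ((hS x).2 hx)).exists_chart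
  have h0t : (0 : EuclideanSpace ℝ (Fin n)) ∈ φ.target := by
    rw [← hc.map_eq_zero]; exact φ.map_source hc.mem_source
  have h0x : φ.symm 0 = x := by rw [← hc.map_eq_zero, φ.left_inv hc.mem_source]
  have hmem : ∀ m, ‖h m‖ ≤ 1 := fun m =>
    mem_closedBall_zero_iff.1 (hr ▸ Set.mem_range_self m)
  have hH := contDiffOn_comp_symm_of_mem_maximalAtlas hh hc.source_mem
  obtain ⟨u, hu, husum, hu0, hud⟩ :=
    hc.exists_eq_sum_sq hf.one_le hpn hf.smooth hh hr hfib hg hfg hS hx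
  let κ : EuclideanSpace ℝ (Fin n) → EuclideanSpace ℝ (Fin n) := fun v => WithLp.toLp 2 fun j =>
    if hj : p ≤ (j : ℕ) + 1 then u v ⟨j, hj⟩ else h (φ.symm v) (s j) - h x (s j)
  have hκ : ∀ v ∈ φ.target, ContDiffAt ℝ ∞ u v → ContDiffAt ℝ ∞ κ v := by
    intro v hvt hv
    refine contDiffAt_euclidean.2 fun j => ?_
    by_cases hj : p ≤ (j : ℕ) + 1
    · simp only [κ, hj, dite_true]
      exact contDiffAt_pi.1 hv _
    · simp only [κ, hj, dite_false]
      exact (contDiffAt_euclidean.1 (hH.contDiffAt (φ.open_target.mem_nhds hvt)) (s j)).sub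
        contDiffAt_const
  have hκev : ∀ᶠ v in 𝓝 0, ContDiffAt ℝ ∞ κ v := by
    filter_upwards [hu, φ.open_target.mem_nhds h0t] with v h1 h2 using hκ v h2 h1
  have hHd : HasFDerivAt (h ∘ φ.symm) (fderiv ℝ (h ∘ φ.symm) 0) 0 :=
    ((hH.contDiffAt (φ.open_target.mem_nhds h0t)).differentiableAt (by simp)).hasFDerivAt
  have hκd : HasFDerivAt κ (fderiv ℝ κ 0) 0 :=
    (hκev.self_of_nhds.differentiableAt (by simp)).hasFDerivAt
  have hudd : HasFDerivAt u (fderiv ℝ u 0) 0 :=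
    (hu.self_of_nhds.differentiableAt (by simp)).hasFDerivAt
  obtain ⟨e, he, h0e, hee⟩ := exists_mem_contDiffGroupoid_of_injective_fderiv hκev (by
    intro a ha
    have hcomp : ∀ j, HasFDerivAt (fun v => κ v j)
        ((EuclideanSpace.proj j : EuclideanSpace ℝ (Fin n) →L[ℝ] ℝ).comp (fderiv ℝ κ 0)) 0 :=
      fun j => (EuclideanSpace.proj (𝕜 := ℝ) j).hasFDerivAt.comp 0 hκd
    have hua : fderiv ℝ u 0 a = 0 := by
      ext ⟨j, hj⟩
      have h1 := hcomp j
      rw [show (fun v => κ v j) = fun v => u v ⟨j, hj⟩ from funext fun v => by simp [κ, hj]] at h1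
      have h2 := h1.unique (hasFDerivAt_pi'.1 hudd ⟨j, hj⟩)
      have h3 := congrArg (fun L => L a) h2
      simpa [ha] using h3.symm
    refine hud a hua ?_
    have hHk : ∀ k ≠ i₀, fderiv ℝ (h ∘ φ.symm) 0 a k = 0 := by
      intro k hk
      obtain ⟨j, hj, rfl⟩ := hs k hk
      have h1 := hcomp j
      rw [show (fun v => κ v j) = fun v => h (φ.symm v) (s j) - h x (s j) from
        funext fun v => by simp [κ, not_le.2 hj]] at h1
      have h2 := h1.unique
        (((EuclideanSpace.proj (𝕜 := ℝ) (s j)).hasFDerivAt.comp 0 hHd).sub_const (h x (s j)))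
      have h3 := congrArg (fun L => L a) h2
      simpa [ha] using h3.symm
    have hin : inner ℝ (h x) (fderiv ℝ (h ∘ φ.symm) 0 a) = 0 := by
      have hmax : IsLocalMax (fun v => ‖(h ∘ φ.symm) v‖ ^ 2) 0 :=
        Filter.Eventually.of_forall fun v => by
          simp only [Function.comp_apply, h0x, hx, one_pow]
          exact pow_le_one₀ (norm_nonneg _) (hmem _)
      have h2 := congrArg (fun L => L a) (hmax.hasFDerivAt_eq_zero hHd.norm_sq)
      simpa [h0x] using h2
    rw [PiLp.inner_apply, Finset.sum_eq_single i₀ (fun k _ hk' => by simp [hHk k hk'])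
      (by simp)] at hin
    have hi : fderiv ℝ (h ∘ φ.symm) 0 a i₀ = 0 := by simpa [hi₀] using hin
    ext k
    by_cases hk : k = i₀
    · rw [hk, hi]; rfl
    · exact hHk k hk)
  obtain ⟨U, hU, hUo, h0U⟩ := eventually_nhds_iff.1 husum
  let χ := φ ≫ₕ e.restr U
  have hsrc : ∀ z, z ∈ χ.source ↔ z ∈ φ.source ∧ φ z ∈ e.source ∧ φ z ∈ U := by
    intro z
    rw [OpenPartialHomeomorph.trans_source, e.restr_source, hUo.interior_eq]
    rfl
  have hχ : ∀ z j, χ z j = κ (φ z) j := fun z j => by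
    change e (φ z) j = _
    rw [hee]
  refine ⟨χ, trans_mem_maximalAtlas hc.source_mem (closedUnderRestriction' he hUo), ?_, ?_, ?_, ?_⟩
  · rw [hsrc, hc.map_eq_zero]
    exact ⟨hc.mem_source, h0e, h0U⟩
  · ext j
    rw [hχ, hc.map_eq_zero]
    by_cases hj : p ≤ (j : ℕ) + 1
    · simp [κ, hj, hu0]
    · simp [κ, hj, h0x]
  · intro z hz j hj
    rw [hχ]
    simp [κ, not_le.2 hj, φ.left_inv ((hsrc z).1 hz).1]
  · intro z hz
    rw [hsrc] at hz
    have h1 := hU _ hz.2.2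
    rw [φ.left_inv hz.1] at h1
    rw [tailSq_eq_sum_subtype, h1]
    refine Finset.sum_congr rfl fun j _ => ?_
    rw [hχ]
    simp [κ, j.2]

end Adapted

/-! ### Singularities and fibres of the projections -/

section Projection

variable {n p q : ℕ} {M : Type*} [TopologicalSpace M] [ChartedSpace (EuclideanSpace ℝ (Fin n)) M]

theorem projFirst_apply (hqp : q ≤ p) (y : EuclideanSpace ℝ (Fin p)) (i : Fin q) :
    projFirst hqp y i = y (Fin.castLE hqp i) := rfl

theorem contDiff_projFirst (hqp : q ≤ p) : ContDiff ℝ ∞ (projFirst hqp) := by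
  refine contDiff_euclidean.2 fun i => ?_
  simp only [projFirst_apply]
  fun_prop

/-- The squared norm splits into the first `q` coordinates and the others. -/
theorem norm_sq_eq_norm_projFirst_sq_add (hqp : q ≤ p) (y : EuclideanSpace ℝ (Fin p)) :
    ‖y‖ ^ 2 = ‖projFirst hqp y‖ ^ 2 + ∑ k : Fin p, if (k : ℕ) < q then 0 else y k ^ 2 := by
  have h1 : ‖projFirst hqp y‖ ^ 2 = ∑ k : Fin p, if (k : ℕ) < q then y k ^ 2 else 0 := by
    rw [EuclideanSpace.real_norm_sq_eq]
    refine Finset.sum_of_injOn (Fin.castLE hqp) (Fin.castLE_injective hqp).injOn (by simp) ?_ ?_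
    · intro k _ hk
      refine if_neg fun hkq => hk ⟨⟨k, hkq⟩, by simp, rfl⟩
    · intro i _
      simp [projFirst_apply]
  rw [h1, EuclideanSpace.real_norm_sq_eq, ← Finset.sum_add_distrib]
  refine Finset.sum_congr rfl fun k _ => ?_
  split_ifs <;> simp

theorem norm_projFirst_le (hqp : q ≤ p) (y : EuclideanSpace ℝ (Fin p)) :
    ‖projFirst hqp y‖ ≤ ‖y‖ := by
  refine le_of_sq_le_sq ?_ (norm_nonneg y)
  rw [norm_sq_eq_norm_projFirst_sq_add hqp y]
  exact le_add_of_nonneg_right (Finset.sum_nonneg fun k _ => by split_ifs <;> positivity)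

/-- The section of `projFirst` that appends zeros. -/
def extendZero (p : ℕ) {q : ℕ} (z : EuclideanSpace ℝ (Fin q)) : EuclideanSpace ℝ (Fin p) :=
  WithLp.toLp 2 fun k => if hk : (k : ℕ) < q then z ⟨k, hk⟩ else 0

theorem projFirst_extendZero (hqp : q ≤ p) (z : EuclideanSpace ℝ (Fin q)) :
    projFirst hqp (extendZero p z) = z := by
  ext i
  simp [projFirst_apply, extendZero]

theorem norm_extendZero (hqp : q ≤ p) (z : EuclideanSpace ℝ (Fin q)) :
    ‖extendZero p z‖ = ‖z‖ := by
  have h := norm_sq_eq_norm_projFirst_sq_add hqp (extendZero p z)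
  rw [projFirst_extendZero, Finset.sum_eq_zero, add_zero] at h
  · exact (pow_left_inj₀ (norm_nonneg _) (norm_nonneg _) two_ne_zero).1 h
  · intro k _
    by_cases hk : (k : ℕ) < q <;> simp [extendZero, hk]

theorem image_projFirst_closedBall (hqp : q ≤ p) :
    projFirst hqp '' Metric.closedBall 0 1 = Metric.closedBall 0 1 := by
  ext z
  simp only [Set.mem_image, mem_closedBall_zero_iff]
  refine ⟨?_, fun hz => ⟨extendZero p z, ?_, projFirst_extendZero hqp z⟩⟩
  · rintro ⟨y, hy, rfl⟩
    exact (norm_projFirst_le hqp y).trans hy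
  · rwa [norm_extendZero hqp]

theorem convex_preimage_projFirst (hqp : q ≤ p) (z : EuclideanSpace ℝ (Fin q)) :
    Convex ℝ (projFirst hqp ⁻¹' {z}) := by
  intro y hy y' hy' a b _ _ hab
  have h1 : projFirst hqp (a • y + b • y') = a • projFirst hqp y + b • projFirst hqp y' := by
    ext i; simp [projFirst_apply]
  rw [Set.mem_preimage, Set.mem_singleton_iff] at *
  rw [h1, hy, hy', ← add_smul, hab, one_smul]

theorem isPreconnected_preimage_projFirst_comp [CompactSpace M] (hqp : q ≤ p)
    {h : M → EuclideanSpace ℝ (Fin p)} (hh : Continuous h)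
    (hr : Set.range h = Metric.closedBall 0 1) (hfib : ∀ y, IsPreconnected (h ⁻¹' {y}))
    (z : EuclideanSpace ℝ (Fin q)) : IsPreconnected ((projFirst hqp ∘ h) ⁻¹' {z}) := by
  have hmem : ∀ m, h m ∈ Metric.closedBall 0 1 := fun m => hr ▸ Set.mem_range_self m
  have : (projFirst hqp ∘ h) ⁻¹' {z} =
      h ⁻¹' (projFirst hqp ⁻¹' {z} ∩ Metric.closedBall 0 1) := by
    ext m
    simp only [Set.mem_preimage, Set.mem_inter_iff, hmem m, and_true, Function.comp_apply]
  rw [this]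
  exact ((convex_preimage_projFirst hqp z).inter
    (convex_closedBall 0 1)).isPreconnected.preimage_of_isClosedMap_of_fibers hh.isClosedMap hfib
    (hr ▸ Set.inter_subset_right)

/-- The singular points of the projection of `h` to the first coordinates. -/
theorem of_mem_singularLocus_projFirst_comp [IsManifold (𝓡 n) ∞ M] [CompactSpace M] [T1Space M]
    (hqp : q ≤ p) {f h : M → EuclideanSpace ℝ (Fin p)}
    {g : EuclideanSpace ℝ (Fin p) → EuclideanSpace ℝ (Fin p)}
    (hpn : p < n) (hf : IsSpecialGeneric n f) (hh : ContMDiff (𝓡 n) (𝓡 p) ∞ h)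
    (hr : Set.range h = Metric.closedBall 0 1) (hfib : ∀ y, IsPreconnected (h ⁻¹' {y}))
    (hg : ContDiffOn ℝ ∞ g (Metric.closedBall 0 1)) (hfg : ∀ x, f x = g (h x))
    (hS : ∀ x, x ∈ singularLocus n f ↔ ‖h x‖ = 1) {x : M}
    (hx : x ∈ singularLocus n (projFirst hqp ∘ h)) :
    ‖h x‖ = 1 ∧ ∀ k : Fin p, q ≤ k → h x k = 0 := by
  have hkd : MDifferentiableAt (𝓡 n) (𝓡 q) (projFirst hqp ∘ h) x :=
    ((contDiff_projFirst hqp).contMDiff.comp hh).mdifferentiableAt (by simp)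
  have hhd : MDifferentiableAt (𝓡 n) (𝓡 p) h x := hh.mdifferentiableAt (by simp)
  have hx1 : ‖h x‖ = 1 := by
    by_contra hne
    have hfs : Function.Surjective (mfderiv (𝓡 n) (𝓡 p) f x) := by
      by_contra hns
      exact hne ((hS x).1 hns)
    have hhs := surjective_mfderiv_of_comp hhd hg (fun m => hr ▸ Set.mem_range_self m) hfg hfs
    refine hx ?_
    have hπ : HasFDerivAt (projFirst hqp) (fderiv ℝ (projFirst hqp) (h x)) (h x) :=
      ((contDiff_projFirst hqp).differentiable (by simp) _).hasFDerivAt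
    have hcomp : HasMFDerivAt (𝓡 n) (𝓡 q) (projFirst hqp ∘ h) x _ :=
      hπ.hasMFDerivAt.comp x hhd.hasMFDerivAt
    rw [hcomp.mfderiv]
    have hπs : Function.Surjective (fderiv ℝ (projFirst hqp) (h x)) := by
      intro b
      refine ⟨extendZero p b, ?_⟩
      ext i
      have h1 := (EuclideanSpace.proj (𝕜 := ℝ) i).hasFDerivAt.comp (h x) hπ
      have h2 := h1.unique (EuclideanSpace.proj (𝕜 := ℝ) (Fin.castLE hqp i)).hasFDerivAt
      have h3 := congrArg (fun L => L (extendZero p b)) h2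
      refine h3.trans ?_
      simp [extendZero]
    exact hπs.comp hhs
  refine ⟨hx1, fun k₀ hk₀ => ?_⟩
  by_contra hne
  have hp : 1 ≤ p := hf.one_le
  let l : Fin p := ⟨p - 1, by omega⟩
  -- If `h x k₀ ≠ 0` with `k₀ ≥ q`, omit the coordinate `k₀` by swapping it with the last one. The
  -- first `q` coordinates of `h` are then chart coordinates, so the projection is a submersion at
  -- `x`.
  let s : Fin n → Fin p := fun j => if hj : (j : ℕ) < p then Equiv.swap k₀ l ⟨j, hj⟩ else l
  have hs : ∀ k ≠ k₀, ∃ j : Fin n, (j : ℕ) + 1 < p ∧ s j = k := by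
    intro k hk
    have h1 : Equiv.swap k₀ l k ≠ l := by
      rw [Ne, ← Equiv.eq_symm_apply]
      simpa using hk
    have h2 : ((Equiv.swap k₀ l k : Fin p) : ℕ) ≠ p - 1 := fun h => h1 (Fin.ext h)
    have h3 := (Equiv.swap k₀ l k).2
    refine ⟨⟨Equiv.swap k₀ l k, by omega⟩, by simp only; omega, ?_⟩
    simp only [s, h3, dite_true, Fin.eta, Equiv.swap_apply_self]
  obtain ⟨χ, hχ⟩ := exists_isAdaptedChart hpn hf hh hr hfib hg hfg hS hx1 hne hs
  refine hx ((surjective_mfderiv_iff_of_mem_maximalAtlas hkd hχ.mem_maximalAtlas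
    hχ.mem_source).2 fun b => ?_)
  have hd := (differentiableAt_comp_symm_of_mem_maximalAtlas hkd hχ.mem_maximalAtlas
    hχ.mem_source).hasFDerivAt
  refine ⟨WithLp.toLp 2 fun j => if hj : (s j : ℕ) < q then b ⟨s j, hj⟩ else 0, ?_⟩
  ext i
  obtain ⟨j, hj, hji⟩ := hs (Fin.castLE hqp i) (by
    intro hik
    have := congrArg Fin.val hik
    have := i.2
    simp at *
    omega)
  have h1 := (EuclideanSpace.proj (𝕜 := ℝ) i).hasFDerivAt.comp (χ x) hd
  have h2 := h1.congr_of_eventuallyEq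
    (f₁ := fun v : EuclideanSpace ℝ (Fin n) => v j + h x (s j)) (by
      filter_upwards [χ.open_target.mem_nhds (χ.map_source hχ.mem_source)] with v hv
      have := hχ.head _ (χ.map_target hv) j hj
      rw [χ.right_inv hv] at this
      rw [this, sub_add_cancel, hji]
      rfl)
  have h3 := h2.unique ((EuclideanSpace.proj (𝕜 := ℝ) j).hasFDerivAt.add_const (h x (s j)))
  have h4 := congrArg (fun L => L (WithLp.toLp 2 fun j =>
    if hj : (s j : ℕ) < q then b ⟨s j, hj⟩ else 0)) h3
  refine h4.trans ?_
  simp [hji]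

/-- In the target, `1 - ‖z‖²` serves as the last coordinate. In the source, an adapted chart
omitting some `i₀ < q` displays `1 - ‖π h‖²` as the sum of the squares of all coordinates after the
first `q - 1`. -/
theorem isDefiniteFoldPoint_projFirst_comp [IsManifold (𝓡 n) ∞ M] [CompactSpace M] [T1Space M]
    (hq : 1 ≤ q) (hqp : q ≤ p) {f h : M → EuclideanSpace ℝ (Fin p)}
    {g : EuclideanSpace ℝ (Fin p) → EuclideanSpace ℝ (Fin p)}
    (hpn : p < n) (hf : IsSpecialGeneric n f) (hh : ContMDiff (𝓡 n) (𝓡 p) ∞ h)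
    (hr : Set.range h = Metric.closedBall 0 1) (hfib : ∀ y, IsPreconnected (h ⁻¹' {y}))
    (hg : ContDiffOn ℝ ∞ g (Metric.closedBall 0 1)) (hfg : ∀ x, f x = g (h x))
    (hS : ∀ x, x ∈ singularLocus n f ↔ ‖h x‖ = 1) {x : M} (hx1 : ‖h x‖ = 1)
    (hx0 : ∀ k : Fin p, q ≤ k → h x k = 0) :
    IsDefiniteFoldPoint n (projFirst hqp ∘ h) x := by
  obtain ⟨i₀, hi₀⟩ : ∃ i : Fin q, projFirst hqp (h x) i ≠ 0 := by
    by_contra! hall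
    have : h x = 0 := by
      ext k
      by_cases hk : (k : ℕ) < q
      · exact hall ⟨k, hk⟩
      · exact hx0 k (not_lt.1 hk)
    simp [this] at hx1
  let l : Fin q := ⟨q - 1, by omega⟩
  let τ : Fin q → Fin q := Equiv.swap i₀ l
  have hτ : ∀ k ≠ i₀, τ k ≠ l := by
    intro k hk
    rw [Ne, ← Equiv.eq_symm_apply]
    simpa using hk
  have hττ : ∀ k, τ (τ k) = k := Equiv.swap_apply_self _ _
  -- The first `q - 1` slots hold the coordinates below `q` other than `i₀`; the slots up to `p - 2`
  -- hold the coordinates from `q` on, shifted down by one to fill the gap left by `i₀`. Later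
  -- values are irrelevant.
  let s : Fin n → Fin p := fun j =>
    if hj : (j : ℕ) + 1 < q then Fin.castLE hqp (τ ⟨j, by omega⟩) else
      if hj' : (j : ℕ) + 1 < p then ⟨j + 1, hj'⟩ else Fin.castLE hqp l
  have hs : ∀ k ≠ Fin.castLE hqp i₀, ∃ j : Fin n, (j : ℕ) + 1 < p ∧ s j = k := by
    intro k hk
    by_cases hkq : (k : ℕ) < q
    · have h1 := hτ ⟨k, hkq⟩ fun h => hk (Fin.ext (by rw [← h]; rfl))
      have h2 : ((τ ⟨k, hkq⟩ : Fin q) : ℕ) ≠ q - 1 := fun h => h1 (Fin.ext h)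
      have h3 := (τ ⟨k, hkq⟩).2
      have h4 : ((τ ⟨k, hkq⟩ : Fin q) : ℕ) + 1 < q := by omega
      refine ⟨⟨τ ⟨k, hkq⟩, by omega⟩, by simp only; omega, ?_⟩
      simp only [s, h4, dite_true, Fin.eta, hττ]
      rfl
    · have hk2 := k.2
      have h4 : ¬ ((k : ℕ) - 1 + 1 < q) := by omega
      have h5 : (k : ℕ) - 1 + 1 < p := by omega
      refine ⟨⟨k - 1, by omega⟩, by simp only; omega, ?_⟩
      simp only [s, h4, h5, dite_true, dite_false]
      exact Fin.ext (by simp only; omega)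
  obtain ⟨χ, hχ⟩ := exists_isAdaptedChart hpn hf hh hr hfib hg hfg hS hx1
    (i₀ := Fin.castLE hqp i₀) hi₀ hs
  obtain ⟨e, he, hxe, hee⟩ := exists_sphere_coordinates (projFirst hqp (h x))
    (projFirst hqp (h x)) hi₀ l τ (fun k hk => ⟨τ k, hτ k hk, hττ k⟩)
  have hcont : Continuous (projFirst hqp ∘ h) :=
    (contDiff_projFirst hqp).continuous.comp hh.continuous
  let U := (projFirst hqp ∘ h) ⁻¹' e.source
  have hU : IsOpen U := e.open_source.preimage hcont
  refine ⟨n + 1 - q, ⟨le_rfl, χ.restr U, restr_mem_maximalAtlas _ hχ.mem_maximalAtlas hU, e,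
    StructureGroupoid.mem_maximalAtlas_of_mem_groupoid _ he, ?_, hχ.map_eq_zero, ?_, ?_⟩, by simp⟩
  · rw [χ.restr_source, hU.interior_eq]
    exact ⟨hχ.mem_source, hxe⟩
  · intro z hz
    rw [χ.restr_source, hU.interior_eq] at hz
    exact hz.2
  · intro z hz
    rw [χ.restr_source, hU.interior_eq] at hz
    refine ⟨fun i j hij hi => ?_, fun i hi => ?_⟩
    · have hil : i ≠ l := fun h => by
        have := congrArg Fin.val h
        simp only [l] at this
        omega
      rw [hee, if_neg hil]
      change _ = χ z j
      have hjq : (j : ℕ) + 1 < q := by omega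
      rw [hχ.head z hz.1 j (by omega)]
      have hsj : s j = Fin.castLE hqp (τ i) := by
        simp only [s, hjq, dite_true]
        congr 2
        exact Fin.ext hij.symm
      rw [hsj]
      rfl
    · have hil : i = l := Fin.ext (by simp only [l]; omega)
      rw [hee, if_pos hil]
      have hsplit := norm_sq_eq_norm_projFirst_sq_add hqp (h z)
      -- Since `h x k = 0` for `k ≥ q`, the middle chart coordinates are these coordinates of `h`
      -- themselves, without a constant.
      have hmid : (∑ k : Fin p, if (k : ℕ) < q then 0 else h z k ^ 2) =
          ∑ j : Fin n, if (j : ℕ) + 1 < q then 0 else if (j : ℕ) + 1 < p then χ z j ^ 2 else 0 := by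
        have hfilter : (∑ k : Fin p, if (k : ℕ) < q then 0 else h z k ^ 2) =
            ∑ k ∈ Finset.univ.filter (fun k : Fin p => ¬ (k : ℕ) < q), h z k ^ 2 := by
          rw [Finset.sum_filter]
          exact Finset.sum_congr rfl fun k _ => by split_ifs <;> rfl
        rw [hfilter]
        refine Finset.sum_of_injOn (fun k => ⟨k - 1, by omega⟩) ?_ (by simp) ?_ ?_
        · intro k hk k' hk' hkk
          have h1 : ¬ (k : ℕ) < q := by simpa using hk
          have h2 : ¬ (k' : ℕ) < q := by simpa using hk'
          have h3 : (k : ℕ) - 1 = k' - 1 := congrArg Fin.val hkk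
          exact Fin.ext (by omega)
        · intro j _ hj
          by_cases h1 : (j : ℕ) + 1 < q
          · rw [if_pos h1]
          · rw [if_neg h1]
            refine if_neg fun h2 => hj ⟨⟨j + 1, h2⟩, ?_, Fin.ext (by simp)⟩
            simpa using h1
        · intro k hk
          have h1 : ¬ (k : ℕ) < q := by simpa using hk
          have h2 : ¬ ((k : ℕ) - 1 + 1 < q) := by omega
          have h3 : (k : ℕ) - 1 + 1 < p := by omega
          have h4 : s ⟨k - 1, by omega⟩ = k := by
            simp only [s, h2, h3, dite_true, dite_false]
            exact Fin.ext (by simp only; omega)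
          rw [if_neg h2, if_pos h3, hχ.head z hz.1 _ h3, h4, hx0 k (by omega), sub_zero]
      have htail := hχ.tail z hz.1
      have hsum : (∑ j : Fin n, if (j : ℕ) + 1 < q then 0 else
          if (j : ℕ) + 1 < q + (n + 1 - q) then (χ z j) ^ 2 else -(χ z j) ^ 2) =
          (∑ j : Fin n, if (j : ℕ) + 1 < q then 0 else if (j : ℕ) + 1 < p then χ z j ^ 2 else 0) +
            tailSq p (χ z) := by
        rw [tailSq, ← Finset.sum_add_distrib]
        refine Finset.sum_congr rfl fun j _ => ?_
        have h1 : (j : ℕ) + 1 < q + (n + 1 - q) := by omega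
        by_cases h2 : (j : ℕ) + 1 < q
        · simp [h2, h2.trans_le hqp]
        · by_cases h3 : (j : ℕ) + 1 < p <;> simp [h1, h2, h3]
      change _ = ∑ j : Fin n, if (j : ℕ) + 1 < q then 0 else
          if (j : ℕ) + 1 < q + (n + 1 - q) then (χ z j) ^ 2 else -(χ z j) ^ 2
      rw [hsum, ← hmid, htail, Function.comp_apply]
      linarith

end Projection

/-! ### Assembly -/

/-- The projections of a disk-valued quotient map `h` of a special generic map are standard. -/
theorem isStandardSpecialGeneric_projFirst_comp {n p q : ℕ} [NeZero q] {M : Type*}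
    [TopologicalSpace M] [ChartedSpace (EuclideanSpace ℝ (Fin n)) M] (hM : IsHomotopySphere n M)
    (hqp : q ≤ p) {f h : M → EuclideanSpace ℝ (Fin p)}
    {g : EuclideanSpace ℝ (Fin p) → EuclideanSpace ℝ (Fin p)}
    (hpn : p < n) (hf : IsSpecialGeneric n f) (hh : ContMDiff (𝓡 n) (𝓡 p) ∞ h)
    (hr : Set.range h = Metric.closedBall 0 1) (hfib : ∀ y, IsPreconnected (h ⁻¹' {y}))
    (hg : ContDiffOn ℝ ∞ g (Metric.closedBall 0 1)) (hfg : ∀ x, f x = g (h x))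
    (hS : ∀ x, x ∈ singularLocus n f ↔ ‖h x‖ = 1) :
    IsStandardSpecialGeneric n (projFirst hqp ∘ h) := by
  have := hM.isManifold
  have := hM.compactSpace
  have := hM.t2Space
  have hk : ContMDiff (𝓡 n) (𝓡 q) ∞ (projFirst hqp ∘ h) :=
    (contDiff_projFirst hqp).contMDiff.comp hh
  have hsing : ∀ x ∈ singularLocus n (projFirst hqp ∘ h),
      ‖h x‖ = 1 ∧ ∀ k : Fin p, q ≤ k → h x k = 0 := fun x hx =>
    of_mem_singularLocus_projFirst_comp hqp hpn hf hh hr hfib hg hfg hS hx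
  have hkr : Set.range (projFirst hqp ∘ h) = Metric.closedBall 0 1 := by
    rw [Set.range_comp, hr, image_projFirst_closedBall]
  refine ⟨hM, hqp.trans_lt hpn, ⟨NeZero.one_le, hqp.trans hpn.le, hk, fun x hx => ?_⟩,
    exists_isSteinSmoothStructure hk hkr
      (isPreconnected_preimage_projFirst_comp hqp hh.continuous hr hfib)
      fun x => ⟨fun hx => ?_, fun hx hsurj => ?_⟩⟩
  · exact isDefiniteFoldPoint_projFirst_comp NeZero.one_le hqp hpn hf hh hr hfib hg hfg hS
      (hsing x hx).1 (hsing x hx).2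
  · obtain ⟨hx1, hx0⟩ := hsing x hx
    have h1 := norm_sq_eq_norm_projFirst_sq_add hqp (h x)
    rw [hx1, Finset.sum_eq_zero (fun k _ => by
      split_ifs with hk
      · rfl
      · rw [hx0 k (not_lt.1 hk)]; simp), add_zero, one_pow, eq_comm,
      pow_eq_one_iff_of_nonneg (norm_nonneg _) two_ne_zero] at h1
    exact h1
  · refine (norm_lt_one_of_surjective_mfderiv (hk.mdifferentiableAt (by simp)) (fun m => ?_)
      hsurj).ne hx
    exact mem_closedBall_zero_iff.1 (hkr ▸ Set.mem_range_self m)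

/-- `h = Φ ∘ q_f` for a fixed diffeomorphism `Φ : W_f ≅ D^p ⊂ ℝ^p`; `NeZero q` and `q < p` say
`q ∈ {1, …, p - 1}`. -/
theorem mainTheorem5 {n p : ℕ} [NeZero p]
    {M : Type*} [TopologicalSpace M] [ChartedSpace (EuclideanSpace ℝ (Fin n)) M]
    (f : M → EuclideanSpace ℝ (Fin p)) (hf : IsStandardSpecialGeneric n f)
    [ChartedSpace (EuclideanHalfSpace p) (SteinSpace f)] (hW : IsSteinSmoothStructure n f)
    (Φ : SteinSpace f → EuclideanSpace ℝ (Fin p)) (hΦ : IsDiffeoOntoDisk Φ) :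
    IsStandardSpecialGeneric n (Φ ∘ steinQuot f) ∧
      ∀ (q : ℕ) [NeZero q] (hqp : q < p),
        IsStandardSpecialGeneric n (projFirst hqp.le ∘ Φ ∘ steinQuot f) := by
  have := hf.homotopySphere.isManifold
  obtain ⟨g, hg, hfg, hS⟩ := exists_contDiffOn_comp_eq hW hΦ
  obtain ⟨Ψ, -, hΨ⟩ := hΦ.smooth_inverse
  have hh : ContMDiff (𝓡 n) (𝓡 p) ∞ (Φ ∘ steinQuot f) := hΦ.smooth.comp hW.smooth_quot
  have hr : Set.range (Φ ∘ steinQuot f) = Metric.closedBall 0 1 := by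
    rw [(steinQuot_surjective f).range_comp, hΦ.range_eq]
  have hfib : ∀ y, IsPreconnected ((Φ ∘ steinQuot f) ⁻¹' {y}) := by
    intro y
    by_cases hy : y ∈ Set.range Φ
    · obtain ⟨w, rfl⟩ := hy
      rw [Set.preimage_comp, ← Set.image_singleton,
        Set.preimage_image_eq _ (Function.LeftInverse.injective hΨ)]
      exact isPreconnected_preimage_steinQuot f w
    · rw [Set.preimage_singleton_eq_empty.2 fun ⟨x, hx⟩ => hy ⟨_, hx⟩]
      exact isPreconnected_empty
  have key : ∀ (q : ℕ) [NeZero q] (hqp : q ≤ p),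
      IsStandardSpecialGeneric n (projFirst hqp ∘ Φ ∘ steinQuot f) := fun q _ hqp =>
    isStandardSpecialGeneric_projFirst_comp hf.homotopySphere hqp hf.lt hf.specialGeneric hh hr hfib
      hg hfg hS
  -- For `q = p` the projection is the identity by definition, so `key` applies to `h` itself.
  exact ⟨key p le_rfl, fun q _ hqp => key q hqp.le⟩
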